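/- Let $D$ be a squarefree positive integer, let $M=\mathbb{Q}(\sqrt{-D})\subset\mathbb{C}$ be the corresponding imaginary quadratic field, and let $\mathbb{Z}_M$ be its ring of integers. Let $c\in\mathbb{Z}_M$ with $|c|\ge 159108$ (complex absolute value), and let $\mu$ be a unit of $\mathbb{Z}_M$. Put $\omega=\frac{-1+\sqrt{-3}}{2}$. Then a triple $(U,V,Z)\in\mathbb{Z}_M^3$ is a solution of the system $$cV^2-(c+2)U^2=-2\mu,\qquad (c-2)U^2-cZ^2=-2\mu$$ if and only if $\mu\in\{1,-1,\omega,\omega^2\}$ and $(U,V,Z)=(\pm\varepsilon,\pm\varepsilon,\pm\varepsilon)$ with some choice of the three signs, taken independently of one another, where $\varepsilon=1,\ i,\ \omega^2,\ \omega$ for $\mu=1,\ -1,\ \omega,\ \omega^2$, respectively. (In particular, the system has no solution in $\mathbb{Z}_M$ if $\mu\notin\{1,-1,\omega,\omega^2\}$, or if the corresponding $\varepsilon$ is not in $M$.) -/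

import Mathlib

open scoped NumberField

noncomputable section

/-- The imaginary quadratic field `ℚ(√-D)`, as a subfield of `ℂ`. -/
abbrev ImagQuad (D : ℕ) : IntermediateField ℚ ℂ :=
  IntermediateField.adjoin ℚ {((Real.sqrt D : ℝ) : ℂ) * Complex.I}

/-- The primitive cube root of unity `ω = (-1 + √-3) / 2`. -/
def omega3 : ℂ := (-1 + ((Real.sqrt 3 : ℝ) : ℂ) * Complex.I) / 2

/-- The pairs `(μ, ε)`: `ε = 1, i, ω², ω` corresponds to `μ = 1, -1, ω, ω²`, respectively. -/
def Corresponds (μ ε : ℂ) : Prop :=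
  (μ = 1 ∧ ε = 1) ∨ (μ = -1 ∧ ε = Complex.I) ∨
    (μ = omega3 ∧ ε = omega3 ^ 2) ∨ (μ = omega3 ^ 2 ∧ ε = omega3)

/-- The system of relative Pellian equations
`c V² - (c + 2) U² = -2 μ`, `(c - 2) U² - c Z² = -2 μ`. -/
def PellSystem {R : Type*} [CommRing R] (c μ U V Z : R) : Prop :=
  c * V ^ 2 - (c + 2) * U ^ 2 = -2 * μ ∧ (c - 2) * U ^ 2 - c * Z ^ 2 = -2 * μ

end

/-! Put `x = 2 / c`. The system reads `V² - (1 + x) U² = -x μ`, `Z² - (1 - x) U² = x μ`. If `U² =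
μ`, then `V² = Z² = μ`; otherwise `|U|` is large and, up to sign, `V / U` and `Z / U` approximate
`√(1 + x)` and `√(1 - x)` with error of order `1 / (|c| |U|²)`. For large `c` this is too good.

The obstruction comes from simultaneous Padé approximation. The residues at `0, 1, -1` of `(1 + x
z)^(k + 1/2) / (z^n₀ (z - 1)^n₁ (z + 1)^n₂)`, with `n₀ + n₁ + n₂ = 3 k + 1` and each `nᵢ` equal to
`k` or `k + 1`, are the coefficients of a linear form in `1, √(1 + x), √(1 - x)`. Four facts are
needed: the form is of size about `|x|^(3 k)` (`norm_padeForm_le`); its coefficients are bounded by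
a constant times `2.68^k` (`norm_polar_le`); they become integral after multiplication by `(4 c)^k`
(`mul_polar_mem`); and with `U, V, Z` as weights, one of the three forms of level `k` is nonzero
(`exists_padeForm_ne_zero`).

A nonzero element of the ring of integers has absolute value at least one, so `one_le_pade_bound`
follows. A suitable level `k` (`exists_pade_level`) contradicts it, which gives
`sq_eq_of_pellSystem`. Then `U` has absolute value one, hence trace in `[-2, 2]`, and
`exists_corresponds_sq` lists the possibilities. -/

/-! ### Binomial coefficients at half-integers: size and denominators. -/

theorem choose_succ_mul (s : ℂ) (h : ℕ) :
    ((h : ℂ) + 1) * Ring.choose s (h + 1) = (s - h) * Ring.choose s h := by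
  have := Ring.choose_smul_choose s (Nat.le_succ h)
  simp only [Nat.succ_eq_add_one, Nat.choose_succ_self_right, nsmul_eq_mul, Nat.cast_add,
    Nat.cast_one, Nat.add_sub_cancel_left, Ring.choose_one_right] at this
  rw [this, mul_comm]

theorem norm_choose_succ (s : ℝ) (h : ℕ) :
    ((h : ℝ) + 1) * ‖Ring.choose (s : ℂ) (h + 1)‖ = |s - h| * ‖Ring.choose (s : ℂ) h‖ := by
  have := congrArg norm (choose_succ_mul (s : ℂ) h)
  rw [norm_mul, norm_mul] at this
  have h1 : ‖((h : ℂ) + 1)‖ = (h : ℝ) + 1 := by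
    have : ((h : ℂ) + 1) = ((h + 1 : ℕ) : ℂ) := by push_cast; rfl
    rw [this, Complex.norm_natCast]; push_cast; rfl
  have h2 : ‖((s : ℂ) - h)‖ = |s - h| := by
    rw [← Complex.ofReal_natCast, ← Complex.ofReal_sub, Complex.norm_real, Real.norm_eq_abs]
  rwa [h1, h2] at this

/-- Compare successive ratios: `k + 1/2 - h` is nonnegative and less than `k + 1 - h` as long as `h
≤ k`. At `h = k + 1` the bound is `1`. -/
theorem norm_choose_add_half_le_choose (k h : ℕ) (hk : h ≤ k + 1) :
    ‖Ring.choose (((k + 1 / 2 : ℝ)) : ℂ) h‖ ≤ (k + 1).choose h := by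
  induction h with
  | zero => simp
  | succ h ih =>
    have ih := ih (by omega)
    have e1 := norm_choose_succ (k + 1 / 2) h
    have e2 : ((h : ℝ) + 1) * ((k + 1).choose (h + 1) : ℝ) = (k + 1 - h) * (k + 1).choose h := by
      have := Nat.choose_succ_right_eq (k + 1) h
      have h3 : ((k + 1 - h : ℕ) : ℝ) = k + 1 - h := by
        rw [Nat.cast_sub (by omega)]; push_cast; rfl
      have := congrArg (Nat.cast : ℕ → ℝ) this
      push_cast [h3] at this
      linarith
    have hh : (h : ℝ) ≤ k := by exact_mod_cast (by omega : h ≤ k)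
    rw [abs_of_nonneg (by linarith)] at e1
    have : ((h : ℝ) + 1) * ‖Ring.choose (((k + 1 / 2 : ℝ)) : ℂ) (h + 1)‖ ≤
        ((h : ℝ) + 1) * ((k + 1).choose (h + 1) : ℝ) := by
      rw [e1, e2]; gcongr <;> linarith
    exact le_of_mul_le_mul_left this (by positivity)

/-- Beyond the middle, the coefficients of `(1 + X) ^ (k + 1 / 2)` have absolute value at most one. -/
theorem norm_choose_add_half_le_one (k h : ℕ) (hk : k + 1 ≤ h) :
    ‖Ring.choose ((k : ℂ) + 1 / 2) h‖ ≤ 1 := by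
  have hc : ((k : ℂ) + 1 / 2) = ((k + 1 / 2 : ℝ) : ℂ) := by push_cast; rfl
  rw [hc]
  induction h, hk using Nat.le_induction with
  | base => simpa using norm_choose_add_half_le_choose k (k + 1) le_rfl
  | succ h hk ih =>
    have e1 := norm_choose_succ (k + 1 / 2) h
    have hh : (k : ℝ) + 1 ≤ h := by exact_mod_cast hk
    have : |(k + 1 / 2 : ℝ) - h| ≤ h + 1 := by
      rw [abs_le]; constructor <;> linarith
    have h2 : ((h : ℝ) + 1) * ‖Ring.choose (((k + 1 / 2 : ℝ)) : ℂ) (h + 1)‖ ≤ ((h : ℝ) + 1) * 1 := by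
      rw [e1]; gcongr
    exact le_of_mul_le_mul_left h2 (by positivity)

theorem norm_choose_half_le_one (h : ℕ) : ‖Ring.choose (1 / 2 : ℂ) h‖ ≤ 1 := by
  rcases Nat.eq_zero_or_pos h with rfl | hh
  · simp
  · simpa using norm_choose_add_half_le_one 0 h hh

theorem neg_four_pow_mul_choose_neg_half (h : ℕ) :
    (-4 : ℂ) ^ h * Ring.choose (-1 / 2 : ℂ) h = Nat.centralBinom h := by
  induction h with
  | zero => simp
  | succ h ih =>
    have e1 := choose_succ_mul (-1 / 2) h
    have e2 := congrArg (Nat.cast : ℕ → ℂ) (Nat.succ_mul_centralBinom_succ h)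
    push_cast at e2
    have h0 : ((h : ℂ) + 1) ≠ 0 := Nat.cast_add_one_ne_zero h
    apply mul_left_cancel₀ h0
    rw [e2, ← ih, pow_succ]
    linear_combination (-4 : ℂ) ^ h * (-4) * e1

/-- Pascal's rule reduces exponent `1/2` to `-1/2`, where central binomial coefficients appear. -/
theorem exists_int_four_pow_mul_choose_half (h : ℕ) :
    ∃ z : ℤ, (4 : ℂ) ^ h * Ring.choose (1 / 2 : ℂ) h = z := by
  have key : ∀ h : ℕ, (4 : ℂ) ^ h * Ring.choose (-1 / 2 : ℂ) h =
      (((-1) ^ h * Nat.centralBinom h : ℤ) : ℂ) := by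
    intro h
    push_cast
    rw [← neg_four_pow_mul_choose_neg_half, ← mul_assoc, ← mul_pow]
    norm_num
  rcases h with _ | h
  · exact ⟨1, by simp⟩
  · refine ⟨4 * ((-1) ^ h * Nat.centralBinom h) + (-1) ^ (h + 1) * Nat.centralBinom (h + 1), ?_⟩
    have e := Ring.choose_succ_succ (-1 / 2 : ℂ) h
    rw [show (-1 / 2 : ℂ) + 1 = 1 / 2 by norm_num] at e
    have h1 := key h
    have h2 := key (h + 1)
    rw [e]
    push_cast at h1 h2 ⊢
    linear_combination 4 * h1 + h2

/-- The binomial series, as a sum of scalars. -/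
theorem hasSum_choose_mul_pow (s : ℂ) {x : ℂ} (hx : ‖x‖ < 1) :
    HasSum (fun h : ℕ => Ring.choose s h * x ^ h) ((1 + x) ^ s) := by
  have := (Complex.one_add_cpow_hasFPowerSeriesOnBall_zero (a := s)).hasSum (y := x)
    (by simpa [Metric.mem_eball, edist_zero_right, ← ofReal_norm] using hx)
  simpa [binomialSeries, FormalMultilinearSeries.coeff_ofScalars, mul_comm] using this

/-! ### Residues at the three nodes and their contiguity relations. -/

section PolarForms

open PowerSeries

/-- The power series of `(1 + y X) ^ (1 / 2)`. -/
noncomputable def sqrtSeries (y : ℂ) : ℂ⟦X⟧ := mk fun h => Ring.choose (1 / 2 : ℂ) h * y ^ h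

/-- The power series of `b ^ e * (1 + y X) ^ (e + 1 / 2)`. -/
noncomputable def numSeries (b y : ℂ) (e : ℕ) : ℂ⟦X⟧ :=
  C (b ^ e) * ((1 + C y * X) ^ e * sqrtSeries y)

/-- The power series of `1 / (d + X)`. -/
noncomputable def invLin (d : ℂ) : ℂ⟦X⟧ := (C d + X)⁻¹

/-- The residue at `X = 0` of
`b ^ e * (1 + y X) ^ (e + 1 / 2) / (X ^ n * (d₁ + X) ^ m₁ * (d₂ + X) ^ m₂)`. -/
noncomputable def polar (b y d₁ d₂ : ℂ) (e n m₁ m₂ : ℕ) : ℂ :=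
  -- The extra factor `X` makes `n` the order of the pole, with value zero for `n = 0`; the
  -- recurrences then need no truncated subtraction.
  coeff n (X * numSeries b y e * invLin d₁ ^ m₁ * invLin d₂ ^ m₂)

theorem lin_mul_invLin {d : ℂ} (hd : d ≠ 0) : (C d + X) * invLin d = 1 :=
  PowerSeries.mul_inv_cancel _ (by simpa using hd)

theorem derivative_invLin (d : ℂ) :
    derivative ℂ (invLin d) = - invLin d ^ 2 := by
  rw [invLin, derivative_inv']
  simp

theorem derivative_sqrtSeries (y : ℂ) :
    (1 + C y * X) * derivative ℂ (sqrtSeries y) = C (y / 2) * sqrtSeries y := by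
  ext n
  rw [add_mul, one_mul, mul_assoc, map_add, coeff_C_mul, coeff_C_mul]
  rcases n with _ | n
  · have := choose_succ_mul (1 / 2) 0
    simp [sqrtSeries, coeff_derivative] at this ⊢
    ring
  · rw [mul_comm X, coeff_succ_mul_X]
    have := choose_succ_mul (1 / 2) (n + 1)
    simp only [sqrtSeries, coeff_derivative, coeff_mk] at this ⊢
    push_cast at this ⊢
    linear_combination y ^ (n + 1 + 1) * this

variable {b y x d₁ d₂ : ℂ}

theorem numSeries_succ (hx : x = b * y) (e : ℕ) :
    numSeries b y (e + 1) = (C b + C x * X) * numSeries b y e := by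
  simp only [numSeries, hx, map_mul, map_pow]
  ring

theorem derivative_numSeries_succ (hx : x = b * y) (e : ℕ) :
    derivative ℂ (numSeries b y (e + 1)) = C ((e + 3 / 2) * x) * numSeries b y e := by
  have h1 := derivative_sqrtSeries y
  have h2 : derivative ℂ ((1 + C y * X : ℂ⟦X⟧) ^ (e + 1)) =
      (e + 1 : ℂ⟦X⟧) * (1 + C y * X) ^ e * C y := by
    rw [Derivation.leibniz_pow]
    simp [derivative_C]
    ring
  have h3 : (C ((e : ℂ) + 3 / 2) : ℂ⟦X⟧) = (e + 1 : ℂ⟦X⟧) + C (1 / 2) := by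
    have : ((e : ℂ) + 3 / 2) = (e : ℂ) + 1 + 1 / 2 := by ring
    rw [this]; simp
  have h4 : (C (y / 2) : ℂ⟦X⟧) = C y * C (1 / 2) := by rw [← map_mul]; congr 1; ring
  simp only [numSeries, Derivation.leibniz, derivative_C, h2, smul_eq_mul, mul_zero, add_zero]
  rw [map_mul, h3, hx, map_mul, map_pow, map_pow]
  rw [h4] at h1
  linear_combination C b ^ (e + 1) * (1 + C y * X) ^ e * h1

theorem polar_swap (b y d₁ d₂ : ℂ) (e n m₁ m₂ : ℕ) :
    polar b y d₁ d₂ e n m₁ m₂ = polar b y d₂ d₁ e n m₂ m₁ := by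
  simp only [polar]; congr 1; ring

/-- Partial fractions: `d₁ / (X (d₁ + X)) = 1 / X - 1 / (d₁ + X)`. -/
theorem polar_partial_fraction (hd : d₁ ≠ 0) (e n m₁ m₂ : ℕ) :
    d₁ * polar b y d₁ d₂ e (n + 1) (m₁ + 1) m₂ =
      polar b y d₁ d₂ e (n + 1) m₁ m₂ - polar b y d₁ d₂ e n (m₁ + 1) m₂ := by
  simp only [polar]
  rw [← coeff_C_mul, ← coeff_succ_X_mul n, ← map_sub]
  congr 1
  linear_combination (X * numSeries b y e * invLin d₁ ^ m₁ * invLin d₂ ^ m₂) * lin_mul_invLin hd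

theorem polar_partial_fraction' (hd₁ : d₁ ≠ 0) (hd₂ : d₂ ≠ 0) (e n m₁ m₂ : ℕ) :
    (d₂ - d₁) * polar b y d₁ d₂ e n (m₁ + 1) (m₂ + 1) =
      polar b y d₁ d₂ e n (m₁ + 1) m₂ - polar b y d₁ d₂ e n m₁ (m₂ + 1) := by
  simp only [polar]
  rw [← coeff_C_mul, ← map_sub, map_sub C]
  congr 1
  linear_combination (X * numSeries b y e * invLin d₁ ^ m₁ * invLin d₂ ^ m₂) *
    (invLin d₁ * lin_mul_invLin hd₂ - invLin d₂ * lin_mul_invLin hd₁)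

/-- Raising `e` multiplies by `b + x X`; here this is read as `b` plus `x` times the local
coordinate, in `polar_raise'` as `(b - d₁ x) + x (d₁ + X)`. -/
theorem polar_raise (hx : x = b * y) (e n m₁ m₂ : ℕ) :
    polar b y d₁ d₂ (e + 1) (n + 1) m₁ m₂ =
      b * polar b y d₁ d₂ e (n + 1) m₁ m₂ + x * polar b y d₁ d₂ e n m₁ m₂ := by
  simp only [polar, numSeries_succ hx]
  rw [← coeff_C_mul, ← coeff_C_mul, ← coeff_succ_X_mul n, ← map_add]
  congr 1
  ring

theorem polar_raise' (hx : x = b * y) (hd : d₁ ≠ 0) (e n m₁ m₂ : ℕ) :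
    polar b y d₁ d₂ (e + 1) n (m₁ + 1) m₂ =
      (b - d₁ * x) * polar b y d₁ d₂ e n (m₁ + 1) m₂ + x * polar b y d₁ d₂ e n m₁ m₂ := by
  simp only [polar, numSeries_succ hx]
  rw [← coeff_C_mul, ← coeff_C_mul, ← map_add]
  congr 1
  rw [map_sub, map_mul]
  linear_combination (C x * X * numSeries b y e * invLin d₁ ^ m₁ * invLin d₂ ^ m₂) *
    lin_mul_invLin hd

/-- The residue of a derivative is zero. Formally: the `n`-th coefficient of `X F'` is `n` times
that of `F`. -/
theorem polar_by_parts (hx : x = b * y) (e n m₁ m₂ : ℕ) :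
    ((e : ℂ) + 3 / 2) * x * polar b y d₁ d₂ e n m₁ m₂ =
      n * polar b y d₁ d₂ (e + 1) (n + 1) m₁ m₂ + m₁ * polar b y d₁ d₂ (e + 1) n (m₁ + 1) m₂ +
        m₂ * polar b y d₁ d₂ (e + 1) n m₁ (m₂ + 1) := by
  set F : ℂ⟦X⟧ := numSeries b y (e + 1) * invLin d₁ ^ m₁ * invLin d₂ ^ m₂ with hF
  have hpow : ∀ (d : ℂ) (m : ℕ),
      derivative ℂ (invLin d ^ m) = - C (m : ℂ) * invLin d ^ (m + 1) := by
    intro d m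
    rw [Derivation.leibniz_pow, derivative_invLin]
    rcases m with _ | m
    · simp
    · simp [pow_succ]; ring
  have hder : derivative ℂ F = C ((e + 3 / 2) * x) * numSeries b y e * invLin d₁ ^ m₁ *
      invLin d₂ ^ m₂ - C (m₁ : ℂ) * numSeries b y (e + 1) * invLin d₁ ^ (m₁ + 1) * invLin d₂ ^ m₂
      - C (m₂ : ℂ) * numSeries b y (e + 1) * invLin d₁ ^ m₁ * invLin d₂ ^ (m₂ + 1) := by
    rw [hF, Derivation.leibniz, Derivation.leibniz, hpow, hpow,
      derivative_numSeries_succ hx]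
    simp only [smul_eq_mul]
    ring
  have h1 : coeff n (X * derivative ℂ F) = n * coeff n F := by
    rcases n with _ | n
    · simp
    · rw [coeff_succ_X_mul, coeff_derivative]; push_cast; ring
  have h2 : polar b y d₁ d₂ (e + 1) (n + 1) m₁ m₂ = coeff n F := by
    rw [polar, ← coeff_succ_X_mul n, hF]; congr 1; ring
  rw [h2, ← h1, hder]
  simp only [polar, ← coeff_C_mul, ← map_add]
  congr 1
  ring

/-- The contiguity relations satisfied by the contour integrals of
`(1 + x z) ^ (e + 1 / 2) / (z ^ n₀ * (z - 1) ^ n₁ * (z + 1) ^ n₂)`. -/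
structure Contiguous (x : ℂ) (E : ℕ → ℕ → ℕ → ℕ → ℂ) : Prop where
  frac01 : ∀ e n₀ n₁ n₂, -E e (n₀ + 1) (n₁ + 1) n₂ = E e (n₀ + 1) n₁ n₂ - E e n₀ (n₁ + 1) n₂
  frac02 : ∀ e n₀ n₁ n₂, E e (n₀ + 1) n₁ (n₂ + 1) = E e (n₀ + 1) n₁ n₂ - E e n₀ n₁ (n₂ + 1)
  frac12 : ∀ e n₀ n₁ n₂, 2 * E e n₀ (n₁ + 1) (n₂ + 1) = E e n₀ (n₁ + 1) n₂ - E e n₀ n₁ (n₂ + 1)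
  raise0 : ∀ e n₀ n₁ n₂, E (e + 1) (n₀ + 1) n₁ n₂ = E e (n₀ + 1) n₁ n₂ + x * E e n₀ n₁ n₂
  raise1 : ∀ e n₀ n₁ n₂,
    E (e + 1) n₀ (n₁ + 1) n₂ = (1 + x) * E e n₀ (n₁ + 1) n₂ + x * E e n₀ n₁ n₂
  raise2 : ∀ e n₀ n₁ n₂,
    E (e + 1) n₀ n₁ (n₂ + 1) = (1 - x) * E e n₀ n₁ (n₂ + 1) + x * E e n₀ n₁ n₂
  parts : ∀ e n₀ n₁ n₂ : ℕ, ((e : ℂ) + 3 / 2) * x * E e n₀ n₁ n₂ =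
    n₀ * E (e + 1) (n₀ + 1) n₁ n₂ + n₁ * E (e + 1) n₀ (n₁ + 1) n₂ + n₂ * E (e + 1) n₀ n₁ (n₂ + 1)

/-- The residue at the node `0`. -/
noncomputable def polar0 (x : ℂ) (e n₀ n₁ n₂ : ℕ) : ℂ := polar 1 x (-1) 1 e n₀ n₁ n₂

/-- The residue at the node `1`, divided by `(1 + x) ^ (1 / 2)`. -/
noncomputable def polar1 (x : ℂ) (e n₀ n₁ n₂ : ℕ) : ℂ :=
  polar (1 + x) (x / (1 + x)) 1 2 e n₁ n₀ n₂

/-- The residue at the node `-1`, divided by `(1 - x) ^ (1 / 2)`. -/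
noncomputable def polar2 (x : ℂ) (e n₀ n₁ n₂ : ℕ) : ℂ :=
  polar (1 - x) (x / (1 - x)) (-1) (-2) e n₂ n₀ n₁

theorem contiguous_polar0 (x : ℂ) : Contiguous x (polar0 x) := by
  have hx : x = 1 * x := by ring
  have n1 : (-1 : ℂ) ≠ 0 := by norm_num
  have n2 : (1 : ℂ) ≠ 0 := by norm_num
  constructor <;> intro e n₀ n₁ n₂ <;> simp only [polar0]
  · linear_combination polar_partial_fraction (b := 1) (y := x) (d₂ := 1) n1 e n₀ n₁ n₂
  · simp only [polar_swap _ _ (-1) 1]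
    linear_combination polar_partial_fraction (b := 1) (y := x) (d₂ := -1) n2 e n₀ n₂ n₁
  · linear_combination polar_partial_fraction' (b := 1) (y := x) n1 n2 e n₀ n₁ n₂
  · linear_combination polar_raise (d₁ := -1) (d₂ := 1) hx e n₀ n₁ n₂
  · linear_combination polar_raise' (d₁ := -1) (d₂ := 1) hx n1 e n₀ n₁ n₂
  · simp only [polar_swap _ _ (-1) 1]
    linear_combination polar_raise' (d₁ := 1) (d₂ := -1) hx n2 e n₀ n₂ n₁
  · linear_combination polar_by_parts hx e n₀ n₁ n₂

theorem contiguous_polar1 {x : ℂ} (h : 1 + x ≠ 0) : Contiguous x (polar1 x) := by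
  have hx : x = (1 + x) * (x / (1 + x)) := by field_simp
  have n1 : (1 : ℂ) ≠ 0 := by norm_num
  have n2 : (2 : ℂ) ≠ 0 := by norm_num
  constructor <;> intro e n₀ n₁ n₂ <;> simp only [polar1]
  · linear_combination -polar_partial_fraction (b := 1 + x) (y := x / (1 + x)) (d₂ := 2) n1 e n₁ n₀ n₂
  · linear_combination polar_partial_fraction' (b := 1 + x) (y := x / (1 + x)) n1 n2 e n₁ n₀ n₂
  · simp only [polar_swap _ _ 1 2]
    linear_combination polar_partial_fraction (b := 1 + x) (y := x / (1 + x)) (d₂ := 1) n2 e n₁ n₂ n₀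
  · linear_combination polar_raise' (d₁ := 1) (d₂ := 2) hx n1 e n₁ n₀ n₂
  · linear_combination polar_raise (d₁ := 1) (d₂ := 2) hx e n₁ n₀ n₂
  · simp only [polar_swap _ _ 1 2]
    linear_combination polar_raise' (d₁ := 2) (d₂ := 1) hx n2 e n₁ n₂ n₀
  · linear_combination polar_by_parts hx e n₁ n₀ n₂

theorem contiguous_polar2 {x : ℂ} (h : 1 - x ≠ 0) : Contiguous x (polar2 x) := by
  have hx : x = (1 - x) * (x / (1 - x)) := by field_simp
  have n1 : (-1 : ℂ) ≠ 0 := by norm_num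
  have n2 : (-2 : ℂ) ≠ 0 := by norm_num
  constructor <;> intro e n₀ n₁ n₂ <;> simp only [polar2]
  · linear_combination polar_partial_fraction' (b := 1 - x) (y := x / (1 - x)) n1 n2 e n₂ n₀ n₁
  · linear_combination -polar_partial_fraction (b := 1 - x) (y := x / (1 - x)) (d₂ := -2) n1 e n₂ n₀ n₁
  · simp only [polar_swap _ _ (-1) (-2)]
    linear_combination -polar_partial_fraction (b := 1 - x) (y := x / (1 - x)) (d₂ := -1) n2 e n₂ n₁ n₀
  · linear_combination polar_raise' (d₁ := -1) (d₂ := -2) hx n1 e n₂ n₀ n₁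
  · simp only [polar_swap _ _ (-1) (-2)]
    linear_combination polar_raise' (d₁ := -2) (d₂ := -1) hx n2 e n₂ n₁ n₀
  · linear_combination polar_raise (d₁ := -1) (d₂ := -2) hx e n₂ n₀ n₁
  · linear_combination polar_by_parts hx e n₂ n₀ n₁

/-- The combination of the three residues with weights `w₀, w₁, w₂`. -/
noncomputable def padeForm (x w₀ w₁ w₂ : ℂ) (e n₀ n₁ n₂ : ℕ) : ℂ :=
  w₀ * polar0 x e n₀ n₁ n₂ + w₁ * polar1 x e n₀ n₁ n₂ + w₂ * polar2 x e n₀ n₁ n₂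

theorem contiguous_padeForm {x : ℂ} (h1 : 1 + x ≠ 0) (h2 : 1 - x ≠ 0) (w₀ w₁ w₂ : ℂ) :
    Contiguous x (padeForm x w₀ w₁ w₂) := by
  have A := contiguous_polar0 x
  have B := contiguous_polar1 h1
  have D := contiguous_polar2 h2
  constructor <;> intro e n₀ n₁ n₂ <;> simp only [padeForm]
  · linear_combination w₀ * A.frac01 e n₀ n₁ n₂ + w₁ * B.frac01 e n₀ n₁ n₂ + w₂ * D.frac01 e n₀ n₁ n₂
  · linear_combination w₀ * A.frac02 e n₀ n₁ n₂ + w₁ * B.frac02 e n₀ n₁ n₂ + w₂ * D.frac02 e n₀ n₁ n₂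
  · linear_combination w₀ * A.frac12 e n₀ n₁ n₂ + w₁ * B.frac12 e n₀ n₁ n₂ + w₂ * D.frac12 e n₀ n₁ n₂
  · linear_combination w₀ * A.raise0 e n₀ n₁ n₂ + w₁ * B.raise0 e n₀ n₁ n₂ + w₂ * D.raise0 e n₀ n₁ n₂
  · linear_combination w₀ * A.raise1 e n₀ n₁ n₂ + w₁ * B.raise1 e n₀ n₁ n₂ + w₂ * D.raise1 e n₀ n₁ n₂
  · linear_combination w₀ * A.raise2 e n₀ n₁ n₂ + w₁ * B.raise2 e n₀ n₁ n₂ + w₂ * D.raise2 e n₀ n₁ n₂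
  · linear_combination w₀ * A.parts e n₀ n₁ n₂ + w₁ * B.parts e n₀ n₁ n₂ + w₂ * D.parts e n₀ n₁ n₂

/-! ### Non-vanishing of the forms, by descent on the level. -/

namespace Contiguous

variable {E : ℕ → ℕ → ℕ → ℕ → ℂ}

/-- If the three forms at level `k + 1` vanish, so do those at level `k`. -/
theorem descend (hE : Contiguous x E) (hx : x ≠ 0) (h1 : 1 + x ≠ 0) (h2 : 1 - x ≠ 0) (k : ℕ)
    (e0 : E (k + 1) (k + 2) (k + 1) (k + 1) = 0) (e1 : E (k + 1) (k + 1) (k + 2) (k + 1) = 0)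
    (e2 : E (k + 1) (k + 1) (k + 1) (k + 2) = 0) :
    E k (k + 1) k k = 0 ∧ E k k (k + 1) k = 0 ∧ E k k k (k + 1) = 0 := by
  have hz : ∀ t : ℂ, x * t = 0 → t = 0 := fun t ht => (mul_eq_zero.mp ht).resolve_left hx
  have hz1 : ∀ t : ℂ, (1 + x) * t = 0 → t = 0 := fun t ht => (mul_eq_zero.mp ht).resolve_left h1
  have hz2 : ∀ t : ℂ, (1 - x) * t = 0 → t = 0 := fun t ht => (mul_eq_zero.mp ht).resolve_left h2
  -- total order `3 k + 3`
  have a : E k (k + 1) (k + 1) (k + 1) = 0 := by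
    have h := hE.parts k (k + 1) (k + 1) (k + 1)
    rw [e0, e1, e2] at h
    have h3 : ((k : ℂ) + 3 / 2) ≠ 0 := by
      intro h0
      have := congrArg Complex.re h0
      norm_num at this
      have : (0 : ℝ) ≤ k := Nat.cast_nonneg k
      linarith
    have : ((k : ℂ) + 3 / 2) * x ≠ 0 := mul_ne_zero h3 hx
    exact (mul_eq_zero.mp (by rw [h]; ring)).resolve_left this
  -- The raising relations lower the exponent from `k + 1` to `k`: first at total order `3 k + 4`,
  -- then (`c01` to `c21`) at order `3 k + 3`.
  have b0 : E k (k + 2) (k + 1) (k + 1) = 0 := by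
    linear_combination e0 - hE.raise0 k (k + 1) (k + 1) (k + 1) - x * a
  have b1 : E k (k + 1) (k + 2) (k + 1) = 0 :=
    hz1 _ (by linear_combination e1 - hE.raise1 k (k + 1) (k + 1) (k + 1) - x * a)
  have b2 : E k (k + 1) (k + 1) (k + 2) = 0 :=
    hz2 _ (by linear_combination e2 - hE.raise2 k (k + 1) (k + 1) (k + 1) - x * a)
  have c01 : E k (k + 2) k (k + 1) = 0 :=
    hz _ (by linear_combination e0 - hE.raise1 k (k + 2) k (k + 1) - (1 + x) * b0)
  have c02 : E k (k + 2) (k + 1) k = 0 :=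
    hz _ (by linear_combination e0 - hE.raise2 k (k + 2) (k + 1) k - (1 - x) * b0)
  have c10 : E k k (k + 2) (k + 1) = 0 :=
    hz _ (by linear_combination e1 - hE.raise0 k k (k + 2) (k + 1) - b1)
  have c12 : E k (k + 1) (k + 2) k = 0 :=
    hz _ (by linear_combination e1 - hE.raise2 k (k + 1) (k + 2) k - (1 - x) * b1)
  have c20 : E k k (k + 1) (k + 2) = 0 :=
    hz _ (by linear_combination e2 - hE.raise0 k k (k + 1) (k + 2) - b2)
  have c21 : E k (k + 1) k (k + 2) = 0 :=
    hz _ (by linear_combination e2 - hE.raise1 k (k + 1) k (k + 2) - (1 + x) * b2)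
  -- integration by parts within one level
  have P : ∀ n₀ n₁ n₂ : ℕ, ((k : ℂ) + 3 / 2 - n₀ - n₁ - n₂) * (x * E k n₀ n₁ n₂) =
      n₀ * E k (n₀ + 1) n₁ n₂ + n₁ * ((1 + x) * E k n₀ (n₁ + 1) n₂) +
        n₂ * ((1 - x) * E k n₀ n₁ (n₂ + 1)) := by
    intro n₀ n₁ n₂
    linear_combination hE.parts k n₀ n₁ n₂ + n₀ * hE.raise0 k n₀ n₁ n₂ +
      n₁ * hE.raise1 k n₀ n₁ n₂ + n₂ * hE.raise2 k n₀ n₁ n₂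
  -- The factor `k + 3/2 - n₀ - n₁ - n₂` is half an odd integer, so never zero, and vanishing passes
  -- from one total order to the next lower. Keeping the factors `nᵢ` in the hypotheses covers `k =
  -- 0`.
  have Q : ∀ n₀ n₁ n₂ : ℕ, (n₀ : ℂ) * E k (n₀ + 1) n₁ n₂ = 0 → (n₁ : ℂ) * E k n₀ (n₁ + 1) n₂ = 0 →
      (n₂ : ℂ) * E k n₀ n₁ (n₂ + 1) = 0 → E k n₀ n₁ n₂ = 0 := by
    intro n₀ n₁ n₂ q0 q1 q2
    have h3 : ((k : ℂ) + 3 / 2 - n₀ - n₁ - n₂) ≠ 0 := by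
      intro h0
      have h0' : ((2 * k + 3 : ℕ) : ℂ) = ((2 * (n₀ + n₁ + n₂) : ℕ) : ℂ) := by
        push_cast; linear_combination 2 * h0
      have := Nat.cast_injective h0'
      omega
    refine hz _ ((mul_eq_zero.mp ?_).resolve_left h3)
    rw [P]
    linear_combination q0 + (1 + x) * q1 + (1 - x) * q2
  have d2 : E k (k + 1) (k + 1) k = 0 := Q _ _ _ (by simp [c02]) (by simp [c12]) (by simp [a])
  have d1 : E k (k + 1) k (k + 1) = 0 := Q _ _ _ (by simp [c01]) (by simp [a]) (by simp [c21])
  have d0 : E k k (k + 1) (k + 1) = 0 := Q _ _ _ (by simp [a]) (by simp [c10]) (by simp [c20])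
  have f0 : E k (k + 2) k k = 0 := by
    linear_combination -hE.frac01 k (k + 1) k k - c02 + d2
  have f1 : E k k (k + 2) k = 0 := by
    linear_combination hE.frac01 k k (k + 1) k + c12 + d2
  have f2 : E k k k (k + 2) = 0 := by
    linear_combination hE.frac02 k k k (k + 1) - c21 + d1
  refine ⟨Q _ _ _ ?_ ?_ ?_, Q _ _ _ ?_ ?_ ?_, Q _ _ _ ?_ ?_ ?_⟩ <;>
    simp [f0, f1, f2, d0, d1, d2]

theorem eq_zero_of_level (hE : Contiguous x E) (hx : x ≠ 0) (h1 : 1 + x ≠ 0) (h2 : 1 - x ≠ 0)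
    (k : ℕ) (e0 : E k (k + 1) k k = 0) (e1 : E k k (k + 1) k = 0) (e2 : E k k k (k + 1) = 0) :
    E 0 1 0 0 = 0 := by
  induction k with
  | zero => exact e0
  | succ k ih =>
    obtain ⟨a, b, c⟩ := hE.descend hx h1 h2 k e0 e1 e2
    exact ih a b c

end Contiguous

/-- Bottom of the descent: only a simple pole at `0` is left, so a nonzero weight `w₀` prevents
simultaneous vanishing. -/
theorem padeForm_zero (x w₀ w₁ w₂ : ℂ) : padeForm x w₀ w₁ w₂ 0 1 0 0 = w₀ := by
  simp [padeForm, polar0, polar1, polar2, polar, numSeries, sqrtSeries]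

/-- The three forms of a level do not vanish simultaneously. -/
theorem exists_padeForm_ne_zero (hx : x ≠ 0) (h1 : 1 + x ≠ 0) (h2 : 1 - x ≠ 0)
    {w₀ : ℂ} (hw : w₀ ≠ 0) (w₁ w₂ : ℂ) (k : ℕ) :
    padeForm x w₀ w₁ w₂ k (k + 1) k k ≠ 0 ∨ padeForm x w₀ w₁ w₂ k k (k + 1) k ≠ 0 ∨
      padeForm x w₀ w₁ w₂ k k k (k + 1) ≠ 0 := by
  by_contra! h
  apply hw
  rw [← padeForm_zero x w₀ w₁ w₂]
  exact (contiguous_padeForm h1 h2 w₀ w₁ w₂).eq_zero_of_level hx h1 h2 k h.1 h.2.1 h.2.2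

end PolarForms

/-! ### Taylor expansion and smallness of the remainder. -/

section Remainder

open PowerSeries

theorem hasSum_of_eq {f g : ℕ → ℂ} {t : ℂ} (hf : HasSum f t) (h : ∀ n, g n = f n) :
    HasSum g t := by
  rwa [show g = f from funext h]

/-- The power series of `X / (1 - a X)`. -/
noncomputable def nodeSeries (a : ℂ) : ℂ⟦X⟧ := X * rescale a (mk 1)

theorem nodeSeries_zero : nodeSeries 0 = X := by
  simp [nodeSeries]

theorem nodeSeries_mul (a b : ℂ) :
    C (a - b) * (nodeSeries a * nodeSeries b) = nodeSeries a - nodeSeries b := by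
  have h : ∀ a : ℂ, (1 - C a * X) * rescale a (mk 1) = 1 := by
    intro a
    have := congrArg (rescale a) (PowerSeries.mk_one_mul_one_sub_eq_one ℂ)
    rw [map_mul, map_sub, map_one, rescale_X] at this
    rw [mul_comm]; exact this
  simp only [nodeSeries, map_sub]
  linear_combination X * rescale a (mk 1) * h b - X * rescale b (mk 1) * h a

theorem coeff_nodeSeries_pow (a : ℂ) (n d : ℕ) :
    coeff (n + d + 1) (nodeSeries a ^ (n + 1)) = (n + d).choose n * a ^ d := by
  rw [nodeSeries, mul_pow, ← map_pow, mk_one_pow_eq_mk_choose_add,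
    show n + d + 1 = d + (n + 1) by ring, coeff_X_pow_mul]
  simp [coeff_rescale, mul_comm]

theorem coeff_nodeSeries_pow_of_lt (a : ℂ) {n h : ℕ} (hh : h < n) :
    coeff h (nodeSeries a ^ n) = 0 := by
  rw [nodeSeries, mul_pow, coeff_X_pow_mul', if_neg (by omega)]

theorem coeff_numSeries (b y : ℂ) (e n : ℕ) :
    coeff n (numSeries b y e) = b ^ e * (Ring.choose ((e : ℂ) + 1 / 2) n * y ^ n) := by
  have h1 : ((1 + C y * X : ℂ⟦X⟧) ^ e * sqrtSeries y) =
      rescale y (binomialSeries ℂ ((e : ℂ) + 1 / 2)) := by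
    rw [binomialSeries_add, binomialSeries_nat, map_mul, map_pow, map_add, map_one, rescale_X]
    congr 1
    ext h
    simp [sqrtSeries, coeff_rescale, mul_comm]
  rw [numSeries, coeff_C_mul, h1, coeff_rescale, binomialSeries_coeff, smul_eq_mul, mul_one,
    mul_comm (y ^ n)]

/-- Taylor expansion of a single residue. -/
theorem hasSum_polar_single {a x b y : ℂ} (hb : b = 1 + a * x) (hax : ‖a * x‖ < 1)
    (hy : x = b * y) (d₁ d₂ : ℂ) (e n : ℕ) :
    HasSum (fun h : ℕ => Ring.choose ((e : ℂ) + 1 / 2) h * x ^ h *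
      coeff (h + 1) (nodeSeries a ^ n)) (b ^ (1 / 2 : ℂ) * polar b y d₁ d₂ e n 0 0) := by
  have hb0 : b ≠ 0 := by
    rintro rfl
    have : a * x = -1 := by linear_combination -hb
    rw [this] at hax; norm_num at hax
  rcases n with _ | n
  · have : polar b y d₁ d₂ e 0 0 0 = 0 := by simp [polar]
    rw [this, mul_zero]
    convert hasSum_zero using 2 with h
    simp [coeff_one]
  · have hp : polar b y d₁ d₂ e (n + 1) 0 0 =
        b ^ e * (Ring.choose ((e : ℂ) + 1 / 2) n * y ^ n) := by
      rw [polar, pow_zero, pow_zero, mul_one, mul_one, coeff_succ_X_mul, coeff_numSeries]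
    set s : ℂ := (e : ℂ) + 1 / 2 with hs
    have hinj : Function.Injective (fun d : ℕ => n + d) := add_right_injective n
    rw [← hinj.hasSum_iff]
    · have hv : b ^ (1 / 2 : ℂ) * polar b y d₁ d₂ e (n + 1) 0 0 =
          Ring.choose s n * x ^ n * b ^ (s - n) := by
        rw [hp, Complex.cpow_sub _ _ hb0, hs, Complex.cpow_add _ _ hb0, Complex.cpow_natCast,
          Complex.cpow_natCast, hy, mul_pow]
        field_simp
      rw [hv, hb]
      have := (hasSum_choose_mul_pow (s - n) hax).mul_left (Ring.choose s n * x ^ n)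
      refine hasSum_of_eq this fun d => ?_
      -- The identity `C(s, n + d) C(n + d, n) = C(s, n) C(s - n, d)` matches the two expansions.
      have h1 := Ring.choose_smul_choose s (Nat.le_add_right n d)
      rw [Nat.add_sub_cancel_left, nsmul_eq_mul] at h1
      simp only [Function.comp]
      rw [coeff_nodeSeries_pow, pow_add, mul_pow]
      linear_combination x ^ n * x ^ d * a ^ d * h1
    · intro h hh
      have : h < n := by
        by_contra hc
        exact hh ⟨h - n, Nat.add_sub_cancel' (not_lt.mp hc)⟩
      rw [coeff_nodeSeries_pow_of_lt _ (by omega), mul_zero]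

/-- The product of the three node series, to the given powers. -/
noncomputable def nodeProd (n₀ n₁ n₂ : ℕ) : ℂ⟦X⟧ :=
  X ^ n₀ * nodeSeries 1 ^ n₁ * nodeSeries (-1) ^ n₂

/-- Expand `(1 + x z)^(e + 1/2)` in powers of `x z`. The sum of the residues of `z^h / ∏ (z - a)^n`
is the coefficient of `z^(-h - 1)` at infinity; with `X = 1 / z`, `1 / (z - a)` becomes `nodeSeries
a`. -/
theorem hasSum_padeForm {x : ℂ} (hx : ‖x‖ < 1) (e n₀ n₁ n₂ : ℕ) :
    HasSum (fun h : ℕ => Ring.choose ((e : ℂ) + 1 / 2) h * x ^ h *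
      coeff (h + 1) (nodeProd n₀ n₁ n₂))
      (padeForm x 1 ((1 + x) ^ (1 / 2 : ℂ)) ((1 - x) ^ (1 / 2 : ℂ)) e n₀ n₁ n₂) := by
  have h1 : 1 + x ≠ 0 := by
    intro h
    rw [show x = -1 by linear_combination h] at hx; norm_num at hx
  have h2 : 1 - x ≠ 0 := by
    intro h
    rw [show x = 1 by linear_combination -h] at hx; norm_num at hx
  have hE := contiguous_padeForm h1 h2 1 ((1 + x) ^ (1 / 2 : ℂ)) ((1 - x) ^ (1 / 2 : ℂ))
  have Y01 : X * nodeSeries 1 = nodeSeries 1 - X := by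
    have := nodeSeries_mul 1 0
    rw [nodeSeries_zero] at this
    simp only [sub_zero, map_one] at this
    linear_combination this
  have Y02 : X * nodeSeries (-1) = X - nodeSeries (-1) := by
    have := nodeSeries_mul 0 (-1)
    rw [nodeSeries_zero] at this
    simp only [zero_sub, neg_neg, map_one] at this
    linear_combination this
  have Y12 : C 2 * (nodeSeries 1 * nodeSeries (-1)) = nodeSeries 1 - nodeSeries (-1) := by
    have := nodeSeries_mul 1 (-1)
    rwa [show (1 : ℂ) - (-1) = 2 by norm_num] at this
  -- Both sides obey the same partial fraction relations, which reduce everything to a single node,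
  -- where the binomial series applies.
  induction hN : n₀ + n₁ + n₂ using Nat.strong_induction_on generalizing n₀ n₁ n₂ with
  | _ N ih =>
  rcases n₀ with _ | n₀
  · rcases n₁ with _ | n₁
    · have hp : padeForm x 1 ((1 + x) ^ (1 / 2 : ℂ)) ((1 - x) ^ (1 / 2 : ℂ)) e 0 0 n₂ =
          (1 - x) ^ (1 / 2 : ℂ) * polar (1 - x) (x / (1 - x)) (-1) (-2) e n₂ 0 0 := by
        simp [padeForm, polar0, polar1, polar2, polar]
      rw [hp]
      simpa [nodeProd] using hasSum_polar_single (a := -1) (x := x) (b := 1 - x)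
        (y := x / (1 - x)) (by ring) (by simpa using hx) (by field_simp) (-1) (-2) e n₂
    · rcases n₂ with _ | n₂
      · have hp : padeForm x 1 ((1 + x) ^ (1 / 2 : ℂ)) ((1 - x) ^ (1 / 2 : ℂ)) e 0 (n₁ + 1) 0 =
            (1 + x) ^ (1 / 2 : ℂ) * polar (1 + x) (x / (1 + x)) 1 2 e (n₁ + 1) 0 0 := by
          simp [padeForm, polar0, polar1, polar2, polar]
        rw [hp]
        simpa [nodeProd] using hasSum_polar_single (a := 1) (x := x) (b := 1 + x)
          (y := x / (1 + x)) (by ring) (by simpa using hx) (by field_simp) 1 2 e (n₁ + 1)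
      · have A := (ih (0 + (n₁ + 1) + n₂) (by omega) 0 (n₁ + 1) n₂ rfl).sub
          (ih (0 + n₁ + (n₂ + 1)) (by omega) 0 n₁ (n₂ + 1) rfl)
        rw [← hE.frac12] at A
        have A := A.mul_left (1 / 2)
        rw [← mul_assoc, show (1 / 2 : ℂ) * 2 = 1 by norm_num, one_mul] at A
        refine hasSum_of_eq A fun h => ?_
        rw [← mul_sub, ← map_sub]
        have : nodeProd 0 (n₁ + 1) n₂ - nodeProd 0 n₁ (n₂ + 1) =
            C 2 * nodeProd 0 (n₁ + 1) (n₂ + 1) := by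
          simp only [nodeProd]
          linear_combination -nodeSeries 1 ^ n₁ * nodeSeries (-1) ^ n₂ * Y12
        rw [this, coeff_C_mul]; ring
  · rcases n₁ with _ | n₁
    · rcases n₂ with _ | n₂
      · have hp : padeForm x 1 ((1 + x) ^ (1 / 2 : ℂ)) ((1 - x) ^ (1 / 2 : ℂ)) e (n₀ + 1) 0 0 =
            (1 : ℂ) ^ (1 / 2 : ℂ) * polar 1 x (-1) 1 e (n₀ + 1) 0 0 := by
          simp [padeForm, polar0, polar1, polar2, polar]
        rw [hp]
        simpa [nodeProd, nodeSeries_zero] using hasSum_polar_single (a := 0) (x := x) (b := 1)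
          (y := x) (by ring) (by simp) (by ring) (-1) 1 e (n₀ + 1)
      · have A := (ih (n₀ + 1 + 0 + n₂) (by omega) (n₀ + 1) 0 n₂ rfl).sub
          (ih (n₀ + 0 + (n₂ + 1)) (by omega) n₀ 0 (n₂ + 1) rfl)
        rw [← hE.frac02] at A
        refine hasSum_of_eq A fun h => ?_
        rw [← mul_sub, ← map_sub]
        congr 2
        simp only [nodeProd]
        linear_combination X ^ n₀ * nodeSeries (-1) ^ n₂ * Y02
    · have A := (ih (n₀ + 1 + n₁ + n₂) (by omega) (n₀ + 1) n₁ n₂ rfl).sub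
        (ih (n₀ + (n₁ + 1) + n₂) (by omega) n₀ (n₁ + 1) n₂ rfl)
      rw [← hE.frac01] at A
      have A := A.neg
      rw [neg_neg] at A
      refine hasSum_of_eq A fun h => ?_
      rw [← mul_sub, ← map_sub, ← mul_neg, ← map_neg]
      congr 2
      simp only [nodeProd]
      linear_combination X ^ n₀ * nodeSeries 1 ^ n₁ * nodeSeries (-1) ^ n₂ * Y01

/-! ### Weighted `ℓ¹` bounds for power series. -/

/-- `MajorizedBy r A F` says that the power series `F` has weighted `ℓ¹`-norm at most `A`. -/
def MajorizedBy (r A : ℝ) (F : ℂ⟦X⟧) : Prop :=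
  ∀ n : ℕ, ∑ i ∈ Finset.range n, ‖coeff i F‖ * r ^ i ≤ A

namespace MajorizedBy

variable {r A B : ℝ} {F G : ℂ⟦X⟧}

theorem nonneg (hF : MajorizedBy r A F) : 0 ≤ A := by simpa using hF 0

theorem norm_coeff_le (hr : 0 ≤ r) (hF : MajorizedBy r A F) (n : ℕ) : ‖coeff n F‖ * r ^ n ≤ A :=
  (Finset.single_le_sum (f := fun i => ‖coeff i F‖ * r ^ i) (fun i _ => by positivity)
    (Finset.self_mem_range_succ n)).trans (hF (n + 1))

theorem mono (hF : MajorizedBy r A F) (h : A ≤ B) : MajorizedBy r B F := fun n => (hF n).trans h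

theorem mul (hr : 0 ≤ r) (hF : MajorizedBy r A F) (hG : MajorizedBy r B G) :
    MajorizedBy r (A * B) (F * G) := by
  intro n
  calc ∑ i ∈ Finset.range n, ‖coeff i (F * G)‖ * r ^ i
      ≤ ∑ i ∈ Finset.range n, ∑ p ∈ Finset.HasAntidiagonal.antidiagonal i,
          (‖coeff p.1 F‖ * r ^ p.1) * (‖coeff p.2 G‖ * r ^ p.2) := by
        refine Finset.sum_le_sum fun i _ => ?_
        rw [coeff_mul]
        refine (mul_le_mul_of_nonneg_right (norm_sum_le _ _) (by positivity)).trans ?_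
        rw [Finset.sum_mul]
        refine Finset.sum_le_sum fun p hp => ?_
        rw [← Finset.HasAntidiagonal.mem_antidiagonal.mp hp, norm_mul, pow_add]
        exact le_of_eq (by ring)
    _ = ∑ q ∈ (Finset.range n).sigma fun i => Finset.HasAntidiagonal.antidiagonal i,
          (‖coeff q.2.1 F‖ * r ^ q.2.1) * (‖coeff q.2.2 G‖ * r ^ q.2.2) := by
        rw [Finset.sum_sigma]
    _ = ∑ p ∈ ((Finset.range n).sigma fun i => Finset.HasAntidiagonal.antidiagonal i).image (fun q => q.2),
          (‖coeff p.1 F‖ * r ^ p.1) * (‖coeff p.2 G‖ * r ^ p.2) := by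
        rw [Finset.sum_image]
        rintro ⟨i, p⟩ h ⟨j, q⟩ h' (rfl : p = q)
        simp only [Finset.coe_sigma, Set.mem_sigma_iff, Finset.mem_coe,
          Finset.HasAntidiagonal.mem_antidiagonal] at h h'
        obtain rfl : i = j := by rw [← h.2, ← h'.2]
        rfl
    _ ≤ ∑ p ∈ Finset.range n ×ˢ Finset.range n,
          (‖coeff p.1 F‖ * r ^ p.1) * (‖coeff p.2 G‖ * r ^ p.2) := by
        refine Finset.sum_le_sum_of_subset_of_nonneg ?_ fun p _ _ => by positivity
        intro p hp
        simp only [Finset.mem_image, Finset.mem_sigma, Finset.mem_range,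
          Finset.HasAntidiagonal.mem_antidiagonal, Finset.mem_product] at hp ⊢
        obtain ⟨⟨i, q⟩, ⟨h1, h2⟩, rfl⟩ := hp
        simp only at h1 h2 ⊢
        omega
    _ = (∑ i ∈ Finset.range n, ‖coeff i F‖ * r ^ i) *
          ∑ i ∈ Finset.range n, ‖coeff i G‖ * r ^ i := by
        rw [Finset.sum_product, Finset.sum_mul_sum]
    _ ≤ A * B := by
        refine mul_le_mul (hF n) (hG n) (Finset.sum_nonneg fun i _ => by positivity) hF.nonneg

theorem C_mul (c : ℂ) (hF : MajorizedBy r A F) : MajorizedBy r (‖c‖ * A) (C c * F) := by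
  intro n
  refine le_trans (le_of_eq ?_) (mul_le_mul_of_nonneg_left (hF n) (norm_nonneg c))
  rw [Finset.mul_sum]
  exact Finset.sum_congr rfl fun i _ => by rw [coeff_C_mul, norm_mul, mul_assoc]

theorem one (r : ℝ) : MajorizedBy r 1 1 := by
  intro n
  rcases n with _ | n
  · simp
  · rw [Finset.sum_range_succ']
    simp [coeff_one]

theorem pow (hr : 0 ≤ r) (hF : MajorizedBy r A F) (m : ℕ) : MajorizedBy r (A ^ m) (F ^ m) := by
  induction m with
  | zero => simpa using one r
  | succ m ih => rw [pow_succ, pow_succ]; exact ih.mul hr hF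

theorem add (hF : MajorizedBy r A F) (hr : 0 ≤ r) (hG : MajorizedBy r B G) :
    MajorizedBy r (A + B) (F + G) := by
  intro n
  refine le_trans ?_ (add_le_add (hF n) (hG n))
  rw [← Finset.sum_add_distrib]
  refine Finset.sum_le_sum fun i _ => ?_
  rw [map_add, ← add_mul]
  exact mul_le_mul_of_nonneg_right (norm_add_le _ _) (by positivity)

theorem X (hr : 0 ≤ r) : MajorizedBy r r PowerSeries.X := by
  intro n
  rcases n with _ | _ | n
  · simpa
  · simpa
  · rw [Finset.sum_range_succ', Finset.sum_range_succ']
    simp [coeff_X]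

/-- A power series with coefficients bounded by a geometric progression. -/
theorem of_geometric {K q : ℝ} (hr : 0 ≤ r) (hK : 0 ≤ K) (hq : 0 ≤ q) (hqr : q * r < 1)
    (hF : ∀ i, ‖coeff i F‖ ≤ K * q ^ i) : MajorizedBy r (K * (1 - q * r)⁻¹) F := by
  intro n
  calc ∑ i ∈ Finset.range n, ‖coeff i F‖ * r ^ i
      ≤ ∑ i ∈ Finset.range n, K * (q * r) ^ i := by
        refine Finset.sum_le_sum fun i _ => ?_
        rw [mul_pow, ← mul_assoc]
        exact mul_le_mul_of_nonneg_right (hF i) (by positivity)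
    _ = K * ∑ i ∈ Finset.range n, (q * r) ^ i := by rw [Finset.mul_sum]
    _ ≤ K * (1 - q * r)⁻¹ := by
        refine mul_le_mul_of_nonneg_left ?_ hK
        rw [← tsum_geometric_of_lt_one (by positivity) hqr]
        exact (summable_geometric_of_lt_one (by positivity) hqr).sum_le_tsum _
          fun i _ => by positivity

end MajorizedBy

theorem majorizedBy_nodeSeries {r : ℝ} (hr : 0 ≤ r) (hr1 : r < 1) {a : ℂ} (ha : ‖a‖ ≤ 1) :
    MajorizedBy r (r * (1 - r)⁻¹) (nodeSeries a) := by
  refine (MajorizedBy.X hr).mul hr ?_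
  have := MajorizedBy.of_geometric (F := rescale a (mk 1)) (K := 1) (q := 1) hr zero_le_one
    zero_le_one (by linarith) (fun i => by
      simpa [coeff_rescale] using pow_le_one₀ (norm_nonneg a) ha)
  simpa using this

theorem majorizedBy_nodeProd {r : ℝ} (hr : 0 ≤ r) (hr1 : r < 1) (n₀ n₁ n₂ : ℕ) :
    MajorizedBy r (r ^ n₀ * (r * (1 - r)⁻¹) ^ (n₁ + n₂)) (nodeProd n₀ n₁ n₂) := by
  rw [pow_add, ← mul_assoc]
  exact (((MajorizedBy.X hr).pow hr n₀).mul hr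
    ((majorizedBy_nodeSeries hr hr1 (by simp)).pow hr n₁)).mul hr
    ((majorizedBy_nodeSeries hr hr1 (by simp)).pow hr n₂)

theorem coeff_nodeProd_of_lt {n₀ n₁ n₂ h : ℕ} (hh : h < n₀ + n₁ + n₂) :
    coeff h (nodeProd n₀ n₁ n₂) = 0 := by
  have : nodeProd n₀ n₁ n₂ =
      X ^ (n₀ + n₁ + n₂) * (rescale 1 (mk 1) ^ n₁ * rescale (-1) (mk 1) ^ n₂) := by
    simp only [nodeProd, nodeSeries]; ring
  rw [this, coeff_X_pow_mul', if_neg (by omega)]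

/-- The remainder of the simultaneous Padé approximation is small. -/
theorem norm_padeForm_le {x : ℂ} (hx0 : x ≠ 0) (hx : ‖x‖ < 1) (k n₀ n₁ n₂ : ℕ)
    (hn : k + 2 ≤ n₀ + n₁ + n₂) :
    ‖padeForm x 1 ((1 + x) ^ (1 / 2 : ℂ)) ((1 - x) ^ (1 / 2 : ℂ)) k n₀ n₁ n₂‖ * ‖x‖ ≤
      ‖x‖ ^ (n₀ + n₁ + n₂) * ((1 - ‖x‖)⁻¹) ^ (n₁ + n₂) := by
  have hx0' : 0 < ‖x‖ := norm_pos_iff.mpr hx0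
  have hs := hasSum_padeForm hx k n₀ n₁ n₂
  have hM := majorizedBy_nodeProd hx0'.le hx n₀ n₁ n₂
  have hA : ‖x‖ ^ n₀ * (‖x‖ * (1 - ‖x‖)⁻¹) ^ (n₁ + n₂) =
      ‖x‖ ^ (n₀ + n₁ + n₂) * ((1 - ‖x‖)⁻¹) ^ (n₁ + n₂) := by
    rw [mul_pow]; ring
  rw [hA] at hM
  set A := ‖x‖ ^ (n₀ + n₁ + n₂) * ((1 - ‖x‖)⁻¹) ^ (n₁ + n₂)
  have hb : ∀ n : ℕ, ‖∑ h ∈ Finset.range n, Ring.choose ((k : ℂ) + 1 / 2) h * x ^ h *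
      coeff (h + 1) (nodeProd n₀ n₁ n₂)‖ * ‖x‖ ≤ A := by
    intro n
    refine le_trans ?_ (hM (n + 1))
    rw [Finset.sum_range_succ']
    refine le_trans ?_ (le_add_of_nonneg_right (by positivity))
    refine (mul_le_mul_of_nonneg_right (norm_sum_le _ _) hx0'.le).trans ?_
    rw [Finset.sum_mul]
    refine Finset.sum_le_sum fun h _ => ?_
    -- Surviving terms have `h ≥ k + 1`, where the binomial coefficient is at most one in absolute
    -- value; the rest is the majorant of the node product.
    rcases lt_or_ge (h + 1) (n₀ + n₁ + n₂) with hlt | hge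
    · simp [coeff_nodeProd_of_lt hlt]
    · have := norm_choose_add_half_le_one k h (by omega)
      rw [norm_mul, norm_mul, norm_pow, pow_succ]
      calc ‖Ring.choose ((k : ℂ) + 1 / 2) h‖ * ‖x‖ ^ h *
            ‖coeff (h + 1) (nodeProd n₀ n₁ n₂)‖ * ‖x‖
          ≤ 1 * ‖x‖ ^ h * ‖coeff (h + 1) (nodeProd n₀ n₁ n₂)‖ * ‖x‖ := by gcongr
        _ = _ := by ring
  exact le_of_tendsto (hs.tendsto_sum_nat.norm.mul_const _) (Filter.Eventually.of_forall hb)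

end Remainder

/-! ### Size and denominators of the residues. -/

section Coefficients

open PowerSeries

theorem invLin_eq {d : ℂ} (hd : d ≠ 0) :
    invLin d = C d⁻¹ * rescale (-d⁻¹) (mk 1) := by
  have h1 : rescale (-d⁻¹) (mk 1) * (1 + C d⁻¹ * X) = (1 : ℂ⟦X⟧) := by
    have := congrArg (rescale (-d⁻¹)) (PowerSeries.mk_one_mul_one_sub_eq_one ℂ)
    rw [map_mul, map_sub, map_one, rescale_X, map_neg] at this
    linear_combination this
  have h2 : (C d * C d⁻¹ : ℂ⟦X⟧) = 1 := by
    rw [← map_mul, mul_inv_cancel₀ hd, map_one]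
  have h3 := lin_mul_invLin hd
  have h4 : (C d + X) * (C d⁻¹ * rescale (-d⁻¹) (mk 1)) = (1 : ℂ⟦X⟧) := by
    linear_combination h1 + (rescale (-d⁻¹) (mk 1)) * h2
  calc invLin d = invLin d * ((C d + X) * (C d⁻¹ * rescale (-d⁻¹) (mk 1))) := by rw [h4, mul_one]
    _ = ((C d + X) * invLin d) * (C d⁻¹ * rescale (-d⁻¹) (mk 1)) := by ring
    _ = _ := by rw [h3, one_mul]

theorem majorizedBy_invLin {d : ℂ} {r : ℝ} (hr : 0 ≤ r) (hd : r < ‖d‖) :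
    MajorizedBy r (‖d‖ - r)⁻¹ (invLin d) := by
  have hd0 : 0 < ‖d‖ := hr.trans_lt hd
  have hd' : d ≠ 0 := norm_pos_iff.mp hd0
  have h1 : ‖d‖⁻¹ * r < 1 := by rw [inv_mul_lt_iff₀ hd0]; linarith
  refine (MajorizedBy.of_geometric (K := ‖d‖⁻¹) (q := ‖d‖⁻¹) hr (by positivity) (by positivity) h1
    fun i => ?_).mono (le_of_eq ?_)
  · rw [invLin_eq hd', coeff_C_mul, coeff_rescale]
    simp
  · rw [← mul_inv, mul_sub, mul_one, ← mul_assoc, mul_inv_cancel₀ hd0.ne', one_mul]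

theorem majorizedBy_numSeries {b y : ℂ} {r : ℝ} (hr : 0 ≤ r) (hy : ‖y‖ * r < 1) (e : ℕ) :
    MajorizedBy r ((‖b‖ * (1 + ‖y‖ * r)) ^ e * (1 - ‖y‖ * r)⁻¹) (numSeries b y e) := by
  have h1 : MajorizedBy r ((1 + ‖y‖ * r) ^ e) ((1 + C y * X : ℂ⟦X⟧) ^ e) :=
    ((MajorizedBy.one r).add hr ((MajorizedBy.X hr).C_mul y)).pow hr e
  have h2 : MajorizedBy r (1 * (1 - ‖y‖ * r)⁻¹) (sqrtSeries y) := by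
    refine MajorizedBy.of_geometric hr zero_le_one (norm_nonneg y) hy fun i => ?_
    rw [sqrtSeries, coeff_mk, norm_mul, norm_pow]
    exact mul_le_mul_of_nonneg_right (norm_choose_half_le_one i) (by positivity)
  refine ((h1.mul hr h2).C_mul (b ^ e)).mono (le_of_eq ?_)
  rw [norm_pow, mul_pow]; ring

/-- Cauchy's estimate on the circle of radius `1/2` about the node `1` or `-1`, whose distances to
the other nodes are `1` and `2`. The factors `2` (pole), `2` (near node) and `2/3` (far node) give
essentially `(8/3)^k`, and `1.0015 * 8/3 < 2.68`. -/
theorem norm_polar_le {b x y d₁ d₂ : ℂ} (hb : b = 1 + x ∨ b = 1 - x) (hx : x = b * y)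
    (hx' : ‖x‖ ≤ 1 / 1000) (hd₁ : ‖d₁‖ = 1) (hd₂ : ‖d₂‖ = 2) {k n m₁ m₂ : ℕ}
    (hs : n + m₁ + m₂ = 3 * k + 1) (hm : m₂ = k ∨ m₂ = k + 1) :
    ‖polar b y d₁ d₂ k n m₁ m₂‖ ≤ 1.01 * (2.68 : ℝ) ^ k := by
  have hb1 : 1 - ‖x‖ ≤ ‖b‖ := by
    rcases hb with rfl | rfl
    · have := norm_sub_norm_le (1 : ℂ) (-x)
      simpa using this
    · have := norm_sub_norm_le (1 : ℂ) x
      simpa using this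
  have hb2 : ‖b‖ ≤ 1 + ‖x‖ := by
    rcases hb with rfl | rfl
    · simpa using norm_add_le (1 : ℂ) x
    · simpa using norm_sub_le (1 : ℂ) x
  have hxy : ‖x‖ = ‖b‖ * ‖y‖ := by rw [hx, norm_mul]
  have hy : ‖y‖ ≤ 2 / 1000 := by nlinarith [norm_nonneg y]
  have hr : (0 : ℝ) ≤ 1 / 2 := by norm_num
  have h1 := majorizedBy_numSeries (b := b) (y := y) (r := 1 / 2) hr (by linarith) k
  have h2 := majorizedBy_invLin (d := d₁) hr (by rw [hd₁]; norm_num)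
  have h3 := majorizedBy_invLin (d := d₂) hr (by rw [hd₂]; norm_num)
  rw [hd₁] at h2
  rw [hd₂] at h3
  have h := (((((MajorizedBy.X hr).mul hr h1).mul hr (h2.pow hr m₁)).mul hr
    (h3.pow hr m₂)).norm_coeff_le hr n)
  change ‖polar b y d₁ d₂ k n m₁ m₂‖ * _ ≤ _ at h
  -- Since `‖b‖ ‖y‖ = ‖x‖`, the left side is at most `1 + (3/2) ‖x‖`.
  have e1 : ‖b‖ * (1 + ‖y‖ * (1 / 2)) ≤ 1.0015 := by
    nlinarith
  have e2 : (1 - ‖y‖ * (1 / 2))⁻¹ ≤ 1.01 := by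
    rw [inv_le_comm₀ (by linarith) (by norm_num)]
    have : (1.01 : ℝ)⁻¹ ≤ 0.999 := by norm_num
    linarith
  have e3 : ((1 : ℝ) - 1 / 2)⁻¹ = 2 := by norm_num
  have e4 : ((2 : ℝ) - 1 / 2)⁻¹ = 2 / 3 := by norm_num
  rw [e3, e4] at h
  have e5 : (1 : ℝ) / 2 * 2 ^ m₁ * (2 / 3) ^ m₂ ≤ (8 / 3) ^ k * (1 / 2) ^ n := by
    have e6 : (1 : ℝ) / 2 * 2 ^ m₁ * (2 / 3) ^ m₂ * 2 ^ n ≤ (8 / 3) ^ k := by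
      rcases hm with rfl | rfl
      · have : (2 : ℝ) ^ m₁ * 2 ^ n = 2 * 4 ^ m₂ := by
          rw [← pow_add, show m₁ + n = 2 * m₂ + 1 by omega, pow_succ, pow_mul]; norm_num; ring
        refine le_of_eq ?_
        rw [show (8 / 3 : ℝ) = 2 / 3 * 4 by norm_num, mul_pow]
        linear_combination (1 / 2) * (2 / 3) ^ m₂ * this
      · have : (2 : ℝ) ^ m₁ * 2 ^ n = 4 ^ k := by
          rw [← pow_add, show m₁ + n = 2 * k by omega, pow_mul]; norm_num
        have e7 : (1 : ℝ) / 2 * 2 ^ m₁ * (2 / 3) ^ (k + 1) * 2 ^ n = (1 / 3) * (8 / 3) ^ k := by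
          rw [show (8 / 3 : ℝ) = 2 / 3 * 4 by norm_num, mul_pow, pow_succ]
          linear_combination (1 / 2) * (2 / 3) ^ k * (2 / 3) * this
        rw [e7]
        have : (0 : ℝ) < (8 / 3) ^ k := by positivity
        linarith
    have e8 : (2 : ℝ) ^ n * (1 / 2) ^ n = 1 := by rw [← mul_pow]; norm_num
    calc (1 : ℝ) / 2 * 2 ^ m₁ * (2 / 3) ^ m₂
        = (1 / 2 * 2 ^ m₁ * (2 / 3) ^ m₂ * 2 ^ n) * (1 / 2) ^ n := by
          linear_combination -(1 / 2 * 2 ^ m₁ * (2 / 3) ^ m₂) * e8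
      _ ≤ _ := mul_le_mul_of_nonneg_right e6 (by positivity)
  have e9 : (‖b‖ * (1 + ‖y‖ * (1 / 2))) ^ k * (1 - ‖y‖ * (1 / 2))⁻¹ ≤ 1.0015 ^ k * 1.01 := by
    have : 0 ≤ (1 - ‖y‖ * (1 / 2))⁻¹ := inv_nonneg.mpr (by linarith)
    gcongr
  have hpos : (0 : ℝ) < (1 / 2) ^ n := by positivity
  refine le_of_mul_le_mul_right (h.trans ?_) hpos
  calc _ = ((‖b‖ * (1 + ‖y‖ * (1 / 2))) ^ k * (1 - ‖y‖ * (1 / 2))⁻¹) *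
        (1 / 2 * 2 ^ m₁ * (2 / 3) ^ m₂) := by ring
    _ ≤ (1.0015 ^ k * 1.01) * ((8 / 3) ^ k * (1 / 2) ^ n) := by
        refine mul_le_mul e9 e5 (by positivity) (by positivity)
    _ = 1.01 * (1.0015 * (8 / 3)) ^ k * (1 / 2) ^ n := by rw [mul_pow]; ring
    _ ≤ 1.01 * (2.68 : ℝ) ^ k * (1 / 2) ^ n := by
        gcongr; norm_num

/-- All coefficients of the power series `F` lie in the subring `O`. -/
def CoeffsIn (O : Subring ℂ) (F : ℂ⟦X⟧) : Prop := ∀ i, coeff i F ∈ O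

namespace CoeffsIn

variable {O : Subring ℂ} {F G : ℂ⟦X⟧}

theorem mul (hF : CoeffsIn O F) (hG : CoeffsIn O G) : CoeffsIn O (F * G) := fun i => by
  rw [coeff_mul]
  exact O.sum_mem fun p _ => O.mul_mem (hF _) (hG _)

theorem one : CoeffsIn O 1 := fun i => by
  rw [coeff_one]
  split_ifs
  · exact O.one_mem
  · exact O.zero_mem

theorem pow (hF : CoeffsIn O F) (m : ℕ) : CoeffsIn O (F ^ m) := by
  induction m with
  | zero => simpa using one
  | succ m ih => rw [pow_succ]; exact ih.mul hF

theorem geometric {t : ℂ} (ht : t ∈ O) : CoeffsIn O (rescale t (mk 1)) := fun i => by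
  rw [coeff_rescale]
  simpa using O.pow_mem ht i

end CoeffsIn

/-- The residues become integral after multiplication by `(4 c) ^ k`. -/
theorem mul_polar_mem {O : Subring ℂ} {c c' b y d₁ d₂ u : ℂ} (hc' : c' ∈ O) (hb : b * c = c')
    (hy : c' * y = 2) (hd₁ : d₁ ≠ 0) (hd₂ : d₂ ≠ 0) (h₁ : 2 * c' / d₁ ∈ O) (h₂ : 2 * c' / d₂ ∈ O)
    {k n m₁ m₂ : ℕ} (hn : n ≤ k) (hu : u ∈ O) (hpow : 4 ^ k = u * 2 ^ n * (d₁ ^ m₁ * d₂ ^ m₂)) :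
    (4 * c) ^ k * polar b y d₁ d₂ k (n + 1) m₁ m₂ ∈ O := by
  -- Substituting `2 c' X` for `X` makes every factor integral: `c' y = 2` turns `1 + y X` into `1 +
  -- 4 X`, whose square root has integer coefficients, and `d / (d + X)` becomes a geometric series
  -- with ratio `-2 c' / d`.
  have hinv : ∀ d : ℂ, d ≠ 0 → 2 * c' / d ∈ O →
      CoeffsIn O (rescale (2 * c') (C d * invLin d)) := by
    intro d hd h
    have : C d * invLin d = rescale (-d⁻¹) (mk 1) := by
      rw [invLin_eq hd, ← mul_assoc, ← map_mul, mul_inv_cancel₀ hd, map_one, one_mul]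
    rw [this, rescale_rescale]
    refine CoeffsIn.geometric ?_
    have := O.neg_mem h
    convert this using 1
    field_simp
  have hlin : CoeffsIn O (rescale (2 * c') (1 + C y * X : ℂ⟦X⟧)) := by
    intro i
    rw [coeff_rescale]
    rcases i with _ | _ | i
    · simp
    · have : (2 * c') ^ (0 + 1) * coeff (0 + 1) (1 + C y * X : ℂ⟦X⟧) = ((4 : ℕ) : ℂ) := by
        simp [coeff_one]
        linear_combination 2 * hy
      rw [this]
      exact natCast_mem O 4
    · simp [coeff_one]
  have hsqrt : CoeffsIn O (rescale (2 * c') (sqrtSeries y)) := by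
    intro i
    obtain ⟨z, hz⟩ := exists_int_four_pow_mul_choose_half i
    have : (2 * c') ^ i * coeff i (sqrtSeries y) = z := by
      rw [← hz, sqrtSeries, coeff_mk, show (4 : ℂ) = 2 * c' * y by linear_combination -2 * hy,
        mul_pow (2 * c') y]
      ring
    rw [coeff_rescale, this]
    exact intCast_mem O z
  have key := (((hlin.pow k).mul hsqrt).mul ((hinv d₁ hd₁ h₁).pow m₁)).mul
    ((hinv d₂ hd₂ h₂).pow m₂) n
  simp only [← map_pow, ← map_mul (rescale (2 * c'))] at key
  rw [coeff_rescale] at key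
  have hp : polar b y d₁ d₂ k (n + 1) m₁ m₂ * (d₁ ^ m₁ * d₂ ^ m₂) =
      b ^ k * coeff n ((1 + C y * X) ^ k * sqrtSeries y * (C d₁ * invLin d₁) ^ m₁ *
        (C d₂ * invLin d₂) ^ m₂) := by
    rw [polar, mul_comm, ← coeff_C_mul, ← coeff_C_mul, ← coeff_succ_X_mul n]
    congr 1
    simp only [numSeries, map_mul, map_pow]
    ring
  -- The scaling costs `(2 c')^n`: `b^k c^k = c'^k` supplies `c'^n` as `n ≤ k`, and `4^k` supplies
  -- `2^n` together with the powers of `d₁, d₂`.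
  have hfin : (4 * c) ^ k * polar b y d₁ d₂ k (n + 1) m₁ m₂ =
      u * c' ^ (k - n) * ((2 * c') ^ n * coeff n ((1 + C y * X) ^ k * sqrtSeries y *
        (C d₁ * invLin d₁) ^ m₁ * (C d₂ * invLin d₂) ^ m₂)) := by
    have h5 : c' ^ k = c' ^ (k - n) * c' ^ n := by rw [← pow_add, Nat.sub_add_cancel hn]
    have h6 : b ^ k * c ^ k = c' ^ k := by rw [← mul_pow, hb]
    rw [mul_pow 4 c, hpow, mul_pow 2 c']
    rw [h5] at h6
    linear_combination u * 2 ^ n * c ^ k * hp + u * 2 ^ n * coeff n ((1 + C y * X) ^ k *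
      sqrtSeries y * (C d₁ * invLin d₁) ^ m₁ * (C d₂ * invLin d₂) ^ m₂) * h6
  rw [hfin]
  exact O.mul_mem (O.mul_mem hu (O.pow_mem hc' _)) key

section Denominators

variable {O : Subring ℂ} {c : ℂ} {k n₀ n₁ n₂ : ℕ}

theorem mul_polar0_mem (hc : c ∈ O) (hc0 : c ≠ 0) (hn : n₀ ≤ k + 1) :
    (4 * c) ^ k * polar0 (2 / c) k n₀ n₁ n₂ ∈ O := by
  rcases n₀ with _ | n
  · simp [polar0, polar]
  · have h2 : (2 : ℂ) ∈ O := ofNat_mem O 2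
    refine mul_polar_mem (c' := c) (u := 2 ^ (2 * k - n) * (-1) ^ n₁) hc (by ring) (by field_simp)
      (by norm_num) (by norm_num) ?_ ?_ (by omega) ?_ ?_
    · rw [div_neg, div_one]; exact O.neg_mem (O.mul_mem h2 hc)
    · simpa using O.mul_mem h2 hc
    · exact O.mul_mem (O.pow_mem h2 _) (O.pow_mem (O.neg_mem O.one_mem) _)
    · have : (4 : ℂ) ^ k = 2 ^ (2 * k - n) * 2 ^ n := by
        rw [← pow_add, Nat.sub_add_cancel (by omega), pow_mul]; norm_num
      have h3 : ((-1 : ℂ)) ^ n₁ * (-1) ^ n₁ = 1 := by rw [← mul_pow]; norm_num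
      rw [this, one_pow]
      linear_combination -(2 ^ (2 * k - n) * 2 ^ n) * h3

theorem mul_polar1_mem (hc : c ∈ O) (hc0 : c ≠ 0) (hc2 : c + 2 ≠ 0) (hn : n₁ ≤ k + 1)
    (hn' : n₁ + n₂ ≤ 2 * k + 1) : (4 * c) ^ k * polar1 (2 / c) k n₀ n₁ n₂ ∈ O := by
  rcases n₁ with _ | n
  · simp [polar1, polar]
  · have h2 : (2 : ℂ) ∈ O := ofNat_mem O 2
    have hc' : c + 2 ∈ O := O.add_mem hc h2
    have hb : (1 + 2 / c) * c = c + 2 := by field_simp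
    have hb0 : 1 + 2 / c ≠ 0 := left_ne_zero_of_mul (hb ▸ hc2)
    refine mul_polar_mem (c' := c + 2) (u := 2 ^ (2 * k - n - n₂)) hc' hb ?_
      (by norm_num) (by norm_num) ?_ ?_ (by omega) (O.pow_mem h2 _) ?_
    · rw [← hb]; field_simp
    · simpa using O.mul_mem h2 hc'
    · simpa using hc'
    -- The node at distance `2` contributes `2^n₂`; the hypothesis `hn'` keeps the total power of
    -- two within `4^k`.
    · rw [one_pow, one_mul, ← pow_add, ← pow_add, show 2 * k - n - n₂ + n + n₂ = 2 * k by omega,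
        pow_mul]
      norm_num

theorem mul_polar2_mem (hc : c ∈ O) (hc0 : c ≠ 0) (hc2 : c - 2 ≠ 0) (hn : n₂ ≤ k + 1)
    (hn' : n₁ + n₂ ≤ 2 * k + 1) : (4 * c) ^ k * polar2 (2 / c) k n₀ n₁ n₂ ∈ O := by
  rcases n₂ with _ | n
  · simp [polar2, polar]
  · have h2 : (2 : ℂ) ∈ O := ofNat_mem O 2
    have hc' : c - 2 ∈ O := O.sub_mem hc h2
    have hb : (1 - 2 / c) * c = c - 2 := by field_simp
    have hb0 : 1 - 2 / c ≠ 0 := left_ne_zero_of_mul (hb ▸ hc2)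
    refine mul_polar_mem (c' := c - 2) (u := 2 ^ (2 * k - n - n₁) * ((-1) ^ n₀ * (-1) ^ n₁)) hc' hb
      ?_ (by norm_num) (by norm_num) ?_ ?_ (by omega) ?_ ?_
    · rw [← hb]; field_simp
    · rw [div_neg, div_one]; exact O.neg_mem (O.mul_mem h2 hc')
    · have : 2 * (c - 2) / -2 = -(c - 2) := by ring
      rw [this]; exact O.neg_mem hc'
    · have h1 := O.neg_mem O.one_mem
      exact O.mul_mem (O.pow_mem h2 _) (O.mul_mem (O.pow_mem h1 _) (O.pow_mem h1 _))
    · have h4 : (4 : ℂ) ^ k = 2 ^ (2 * k - n - n₁) * 2 ^ n * 2 ^ n₁ := by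
        rw [← pow_add, ← pow_add, show 2 * k - n - n₁ + n + n₁ = 2 * k by omega, pow_mul]; norm_num
      have h3 : ∀ m : ℕ, ((-1 : ℂ)) ^ m * (-1) ^ m = 1 := fun m => by rw [← mul_pow]; norm_num
      have h5 : (-2 : ℂ) ^ n₁ = (-1) ^ n₁ * 2 ^ n₁ := by rw [← mul_pow]; norm_num
      rw [h4, h5]
      linear_combination -(2 ^ (2 * k - n - n₁) * 2 ^ n * 2 ^ n₁) * ((-1) ^ n₀ * (-1) ^ n₀ * h3 n₁
        + h3 n₀)

end Denominators

end Coefficients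

/-! ### The approximation bound and the contradiction. -/

section Approximation

/-- A simultaneous approximation to `√(1 + 2 / c)` and `√(1 - 2 / c)` cannot be too good. -/
theorem one_le_pade_bound {O : Subring ℂ} (hO : ∀ z ∈ O, z ≠ 0 → 1 ≤ ‖z‖) {c U V Z : ℂ}
    (hc : c ∈ O) (hU : U ∈ O) (hV : V ∈ O) (hZ : Z ∈ O) (hU0 : U ≠ 0) (hc' : 2000 ≤ ‖c‖)
    {k : ℕ} (hk : 1 ≤ k) :
    1 ≤ 1.1 * ‖U‖ * (33 / ‖c‖ ^ 2) ^ k + 1.01 * (11 * ‖c‖) ^ k *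
      (‖V - (1 + 2 / c) ^ (1 / 2 : ℂ) * U‖ + ‖Z - (1 - 2 / c) ^ (1 / 2 : ℂ) * U‖) := by
  have hcpos : 0 < ‖c‖ := by linarith
  have hc0 : c ≠ 0 := norm_pos_iff.mp hcpos
  set x : ℂ := 2 / c with hx
  have hxn : ‖x‖ = 2 / ‖c‖ := by rw [hx, norm_div]; norm_num
  have hx0 : x ≠ 0 := div_ne_zero two_ne_zero hc0
  have hxpos : 0 < ‖x‖ := norm_pos_iff.mpr hx0
  have hx1 : ‖x‖ ≤ 1 / 1000 := by
    rw [hxn, div_le_div_iff₀ hcpos (by norm_num)]; linarith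
  have h1 : 1 + x ≠ 0 := by
    intro h
    rw [show x = -1 by linear_combination h] at hx1; norm_num at hx1
  have h2 : 1 - x ≠ 0 := by
    intro h
    rw [show x = 1 by linear_combination -h] at hx1; norm_num at hx1
  have hb1 : (1 + x) * c = c + 2 := by rw [hx]; field_simp
  have hb2 : (1 - x) * c = c - 2 := by rw [hx]; field_simp
  have hc1 : c + 2 ≠ 0 := hb1 ▸ mul_ne_zero h1 hc0
  have hc2 : c - 2 ≠ 0 := hb2 ▸ mul_ne_zero h2 hc0
  set s : ℂ := (1 + x) ^ (1 / 2 : ℂ)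
  set t : ℂ := (1 - x) ^ (1 / 2 : ℂ)
  -- `4 * 2.68 < 11`; likewise the `33` in `hrem` comes from `4 * 2^3 * 1.003 < 33`.
  have hq : (4 * ‖c‖) ^ k * (1.01 * (2.68 : ℝ) ^ k) ≤ 1.01 * (11 * ‖c‖) ^ k := by
    have : (4 * ‖c‖) ^ k * (1.01 * (2.68 : ℝ) ^ k) = 1.01 * (4 * ‖c‖ * 2.68) ^ k := by
      rw [mul_pow (4 * ‖c‖) 2.68]; ring
    have h4 : 4 * ‖c‖ * 2.68 ≤ 11 * ‖c‖ := by linarith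
    rw [this]
    gcongr
  have hrem : ∀ n₁₂ : ℕ, n₁₂ ≤ 2 * k + 1 → ∀ G : ℝ, 0 ≤ G →
      G * ‖x‖ ≤ ‖x‖ ^ (3 * k + 1) * ((1 - ‖x‖)⁻¹) ^ n₁₂ →
      (4 * ‖c‖) ^ k * G ≤ 1.1 * (33 / ‖c‖ ^ 2) ^ k := by
    intro m hm G hG h
    have i1 : 1 ≤ (1 - ‖x‖)⁻¹ := (one_le_inv₀ (by linarith)).mpr (by linarith)
    have i2 : (1 - ‖x‖)⁻¹ ≤ 1.0011 := by
      rw [inv_le_comm₀ (by linarith) (by norm_num)]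
      have : (1.0011 : ℝ)⁻¹ ≤ 0.999 := by norm_num
      linarith
    have i3 : ((1 - ‖x‖)⁻¹) ^ m ≤ 1.1 * 1.003 ^ k := by
      calc ((1 - ‖x‖)⁻¹) ^ m ≤ ((1 - ‖x‖)⁻¹) ^ (2 * k + 1) := pow_le_pow_right₀ i1 hm
        _ ≤ 1.0011 ^ (2 * k + 1) := by gcongr
        _ = 1.0011 * (1.0011 ^ 2) ^ k := by rw [pow_succ, pow_mul]; ring
        _ ≤ 1.1 * 1.003 ^ k := by gcongr <;> norm_num
    have i4 : G ≤ ‖x‖ ^ (3 * k) * (1.1 * 1.003 ^ k) := by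
      refine le_of_mul_le_mul_right (h.trans ?_) hxpos
      rw [pow_succ]
      calc _ ≤ ‖x‖ ^ (3 * k) * ‖x‖ * (1.1 * 1.003 ^ k) := by gcongr
        _ = _ := by ring
    calc (4 * ‖c‖) ^ k * G ≤ (4 * ‖c‖) ^ k * (‖x‖ ^ (3 * k) * (1.1 * 1.003 ^ k)) := by gcongr
      _ = 1.1 * (4 * ‖c‖ * ‖x‖ ^ 3 * 1.003) ^ k := by
        rw [mul_pow (4 * ‖c‖ * ‖x‖ ^ 3), mul_pow (4 * ‖c‖), ← pow_mul]; ring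
      _ ≤ 1.1 * (33 / ‖c‖ ^ 2) ^ k := by
        have : 4 * ‖c‖ * ‖x‖ ^ 3 * 1.003 ≤ 33 / ‖c‖ ^ 2 := by
          have e : 4 * ‖c‖ * ‖x‖ ^ 3 * 1.003 = 32.096 / ‖c‖ ^ 2 := by
            rw [hxn]; field_simp; norm_num
          rw [e]; gcongr; norm_num
        gcongr
  have main : ∀ n₀ n₁ n₂ : ℕ, n₀ + n₁ + n₂ = 3 * k + 1 → n₀ ≤ k + 1 → n₁ ≤ k + 1 → n₂ ≤ k + 1 →
      k ≤ n₀ → k ≤ n₁ → k ≤ n₂ → padeForm x U V Z k n₀ n₁ n₂ ≠ 0 →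
      1 ≤ 1.1 * ‖U‖ * (33 / ‖c‖ ^ 2) ^ k + 1.01 * (11 * ‖c‖) ^ k *
        (‖V - s * U‖ + ‖Z - t * U‖) := by
    intro n₀ n₁ n₂ hn hn0 hn1 hn2 hk0 hk1 hk2 hne
    have m0 := mul_polar0_mem (n₁ := n₁) (n₂ := n₂) hc hc0 hn0
    have m1 := mul_polar1_mem (n₀ := n₀) hc hc0 hc1 hn1 (by omega : n₁ + n₂ ≤ 2 * k + 1)
    have m2 := mul_polar2_mem (n₀ := n₀) hc hc0 hc2 hn2 (by omega : n₁ + n₂ ≤ 2 * k + 1)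
    rw [← hx] at m0 m1 m2
    have hmem : (4 * c) ^ k * padeForm x U V Z k n₀ n₁ n₂ ∈ O := by
      have := O.add_mem (O.add_mem (O.mul_mem hU m0) (O.mul_mem hV m1)) (O.mul_mem hZ m2)
      convert this using 1
      simp only [padeForm]; ring
    have h4c : (4 * c) ^ k ≠ 0 := pow_ne_zero _ (mul_ne_zero (by norm_num) hc0)
    have hone := hO _ hmem (mul_ne_zero h4c hne)
    have p1 : ‖polar1 x k n₀ n₁ n₂‖ ≤ 1.01 * (2.68 : ℝ) ^ k :=
      norm_polar_le (Or.inl rfl) (by field_simp) hx1 (by simp) (by simp) (by omega) (by omega)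
    have p2 : ‖polar2 x k n₀ n₁ n₂‖ ≤ 1.01 * (2.68 : ℝ) ^ k := by
      rw [polar2, polar_swap]
      rw [polar_swap]
      exact norm_polar_le (Or.inr rfl) (by field_simp) hx1 (by simp) (by simp)
        (by omega) (by omega)
    have hG := norm_padeForm_le hx0 (by linarith) k n₀ n₁ n₂ (by omega)
    rw [hn] at hG
    have hG' := hrem (n₁ + n₂) (by omega) _ (norm_nonneg _) hG
    -- Subtracting `U` times the small form cancels the residue at `0`, so only the residues at `1`
    -- and `-1` need a size bound.
    have hsplit : padeForm x U V Z k n₀ n₁ n₂ = U * padeForm x 1 s t k n₀ n₁ n₂ +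
        polar1 x k n₀ n₁ n₂ * (V - s * U) + polar2 x k n₀ n₁ n₂ * (Z - t * U) := by
      simp only [padeForm]; ring
    have hnorm : ‖(4 * c) ^ k‖ = (4 * ‖c‖) ^ k := by
      rw [norm_pow, norm_mul]; norm_num
    rw [norm_mul, hnorm, hsplit] at hone
    refine hone.trans ?_
    have hv := norm_nonneg (V - s * U)
    have hz := norm_nonneg (Z - t * U)
    calc (4 * ‖c‖) ^ k * ‖U * padeForm x 1 s t k n₀ n₁ n₂ +
          polar1 x k n₀ n₁ n₂ * (V - s * U) + polar2 x k n₀ n₁ n₂ * (Z - t * U)‖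
        ≤ (4 * ‖c‖) ^ k * (‖U‖ * ‖padeForm x 1 s t k n₀ n₁ n₂‖ +
          (1.01 * (2.68 : ℝ) ^ k) * ‖V - s * U‖ + (1.01 * (2.68 : ℝ) ^ k) * ‖Z - t * U‖) := by
          gcongr
          refine (norm_add_le _ _).trans (add_le_add ((norm_add_le _ _).trans (add_le_add ?_ ?_)) ?_)
          · rw [norm_mul]
          · rw [norm_mul]; gcongr
          · rw [norm_mul]; gcongr
      _ = ‖U‖ * ((4 * ‖c‖) ^ k * ‖padeForm x 1 s t k n₀ n₁ n₂‖) +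
          ((4 * ‖c‖) ^ k * (1.01 * (2.68 : ℝ) ^ k)) * (‖V - s * U‖ + ‖Z - t * U‖) := by ring
      _ ≤ ‖U‖ * (1.1 * (33 / ‖c‖ ^ 2) ^ k) +
          (1.01 * (11 * ‖c‖) ^ k) * (‖V - s * U‖ + ‖Z - t * U‖) := by gcongr
      _ = _ := by ring
  rcases exists_padeForm_ne_zero hx0 h1 h2 hU0 V Z k with h | h | h
  · exact main _ _ _ (by omega) (by omega) (by omega) (by omega) (by omega) (by omega) (by omega) h
  · exact main _ _ _ (by omega) (by omega) (by omega) (by omega) (by omega) (by omega) (by omega) h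
  · exact main _ _ _ (by omega) (by omega) (by omega) (by omega) (by omega) (by omega) (by omega) h

/-- One of `± V` is close to `s U` if `V ^ 2` is close to `s ^ 2 U ^ 2`. -/
theorem exists_sign_norm_sub_le {s U V w δ : ℂ} (hs : 0.98 ≤ ‖s ^ 2‖) (hU : U ≠ 0)
    (h : V ^ 2 - s ^ 2 * U ^ 2 = δ * w) (hw : ‖w‖ = 1) :
    ∃ W, (W = V ∨ W = -V) ∧ ‖W - s * U‖ ≤ 1.02 * ‖δ‖ / ‖U‖ := by
  have hUpos : 0 < ‖U‖ := norm_pos_iff.mpr hU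
  have hs' : 0.9899 ≤ ‖s‖ := by
    rw [norm_pow] at hs
    nlinarith [norm_nonneg s]
  have hprod : ‖V - s * U‖ * ‖V + s * U‖ = ‖δ‖ := by
    rw [← norm_mul, show (V - s * U) * (V + s * U) = δ * w by rw [← h]; ring, norm_mul, hw, mul_one]
  have hsum : 2 * (‖s‖ * ‖U‖) ≤ ‖V - s * U‖ + ‖V + s * U‖ := by
    have := norm_sub_le (V + s * U) (V - s * U)
    rw [show V + s * U - (V - s * U) = 2 * (s * U) by ring, norm_mul, norm_mul] at this
    norm_num at this
    linarith
  have key : ∀ p q : ℝ, 0 ≤ p → p * q = ‖δ‖ → ‖s‖ * ‖U‖ ≤ q → p ≤ 1.02 * ‖δ‖ / ‖U‖ := by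
    intro p q hp hpq hq
    rw [le_div_iff₀ hUpos, ← hpq]
    -- The larger factor `q` is at least `‖s‖ ‖U‖`, and `1.02 * 0.9899 > 1`.
    have : 0.9899 * ‖U‖ ≤ q := by nlinarith
    nlinarith [mul_le_mul_of_nonneg_left this hp]
  rcases le_total ‖V - s * U‖ ‖V + s * U‖ with hle | hle
  · exact ⟨V, Or.inl rfl, key _ _ (norm_nonneg _) hprod (by linarith)⟩
  · refine ⟨-V, Or.inr rfl, ?_⟩
    rw [show -V - s * U = -(V + s * U) by ring, norm_neg]
    exact key _ _ (norm_nonneg _) (by rw [mul_comm]; exact hprod) (by linarith)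

/-- A level of the Padé table fitting an integer of absolute value `u`. -/
theorem exists_pade_level {C u : ℝ} (hC : 159108 ≤ C) (hu : 281 ≤ u) :
    ∃ k : ℕ, 1 ≤ k ∧ 1.1 * u * (33 / C ^ 2) ^ k < 1 / 2 ∧ 4.2 * (11 * C) ^ k ≤ C * u / 2 := by
  have hCpos : 0 < C := by linarith
  have hLbig : 2 < C ^ 2 / 33 := by rw [lt_div_iff₀ (by norm_num)]; nlinarith
  -- As `2.3 > 2 * 1.1`, this is the first inequality at level `k + 1`; minimality of `k` gives the
  -- second.
  have hex : ∃ k : ℕ, 2.3 * u < (C ^ 2 / 33) ^ (k + 1) := by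
    obtain ⟨n, hn⟩ := pow_unbounded_of_one_lt (2.3 * u) (by linarith : 1 < C ^ 2 / 33)
    exact ⟨n, hn.trans_le (pow_le_pow_right₀ (by linarith) (Nat.le_succ n))⟩
  classical
  let k := Nat.find hex
  have hk : 2.3 * u < (C ^ 2 / 33) ^ (k + 1) := Nat.find_spec hex
  refine ⟨k + 1, by omega, ?_, ?_⟩
  · have h1 : (33 / C ^ 2) ^ (k + 1) * (C ^ 2 / 33) ^ (k + 1) = 1 := by
      rw [← mul_pow, div_mul_div_cancel₀ (by positivity)]; norm_num
    have hpos : 0 < (33 / C ^ 2) ^ (k + 1) := by positivity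
    nlinarith [mul_lt_mul_of_pos_left hk hpos]
  · rcases Nat.eq_zero_or_pos k with h0 | hpos
    · rw [h0]; nlinarith
    · obtain ⟨j, hj⟩ := Nat.exists_eq_succ_of_ne_zero hpos.ne'
      have hlow : (C ^ 2 / 33) ^ (j + 1) ≤ 2.3 * u := by
        have := Nat.find_min hex (m := j) (by change j < k; omega)
        exact not_lt.mp this
      rw [hj]
      have hpow : (C ^ 2 / 33) ^ (j + 1) = (11 * C) ^ (j + 1) * (C / 363) ^ (j + 1) := by
        rw [← mul_pow]; congr 1; ring
      -- Here the lower bound on `C` enters: `159108 / 363 > 438`, and `438 / 2.3 > 190`.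
      have hbig : 438 ≤ (C / 363) ^ (j + 1) := by
        have h438 : 438 ≤ C / 363 := by rw [le_div_iff₀ (by norm_num)]; linarith
        calc (438 : ℝ) ≤ C / 363 := h438
          _ ≤ (C / 363) ^ (j + 1) := le_self_pow₀ (by linarith) (by omega)
      have hpp : 0 < (11 * C) ^ (j + 1) := by positivity
      rw [hpow] at hlow
      have h3 : 190 * (11 * C) ^ (j + 1) ≤ u := by
        nlinarith [mul_le_mul_of_nonneg_left hbig hpp.le]
      rw [Nat.succ_eq_add_one, pow_succ]
      nlinarith [mul_le_mul_of_nonneg_left h3 hCpos.le]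

/-- In a discrete subring, the system forces `U ^ 2 = μ`. -/
theorem sq_eq_of_pellSystem {O : Subring ℂ} (hO : ∀ z ∈ O, z ≠ 0 → 1 ≤ ‖z‖) {c μ U V Z : ℂ}
    (hc : c ∈ O) (hU : U ∈ O) (hV : V ∈ O) (hZ : Z ∈ O) (hμ1 : ‖μ‖ = 1)
    (hC : 159108 ≤ ‖c‖) (h : PellSystem c μ U V Z) : U ^ 2 = μ ∧ V ^ 2 = μ ∧ Z ^ 2 = μ := by
  have hcpos : 0 < ‖c‖ := by linarith
  have hc0 : c ≠ 0 := norm_pos_iff.mp hcpos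
  obtain ⟨hV2, hZ2⟩ := h
  have hVU : c * (V ^ 2 - U ^ 2) = 2 * (U ^ 2 - μ) := by linear_combination hV2
  have hZU : c * (Z ^ 2 - U ^ 2) = -2 * (U ^ 2 - μ) := by linear_combination -hZ2
  by_cases hne : U ^ 2 = μ
  · rw [hne, sub_self, mul_zero] at hVU hZU
    refine ⟨hne, ?_, ?_⟩
    · exact sub_eq_zero.mp ((mul_eq_zero.mp hVU).resolve_left hc0)
    · exact sub_eq_zero.mp ((mul_eq_zero.mp hZU).resolve_left hc0)
  exfalso
  have hdne : V ^ 2 - U ^ 2 ≠ 0 := by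
    intro h0
    rw [h0, mul_zero] at hVU
    exact hne (sub_eq_zero.mp ((mul_eq_zero.mp hVU.symm).resolve_left two_ne_zero))
  have hd1 := hO _ (O.sub_mem (O.pow_mem hV 2) (O.pow_mem hU 2)) hdne
  -- `V² - U²` is a nonzero element of `O`, hence at least one in absolute value, so `c` divides its
  -- cost into `2 (U² - μ)`; this yields `|U| ≥ 281`.
  have hu2 : ‖c‖ ≤ 2 * (‖U‖ ^ 2 + 1) := by
    have e := congrArg norm hVU
    rw [norm_mul, norm_mul] at e
    have e2 : ‖U ^ 2 - μ‖ ≤ ‖U‖ ^ 2 + 1 := by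
      rw [← norm_pow, ← hμ1]; exact norm_sub_le _ _
    norm_num at e
    nlinarith
  have hu : 281 ≤ ‖U‖ := by nlinarith [norm_nonneg U]
  have hU0 : U ≠ 0 := norm_pos_iff.mp (by linarith)
  have hxn : ‖2 / c‖ = 2 / ‖c‖ := by rw [norm_div]; norm_num
  have hx1 : ‖2 / c‖ ≤ 0.02 := by
    rw [hxn, div_le_iff₀ hcpos]; linarith
  have hsq : ∀ z : ℂ, (z ^ (1 / 2 : ℂ)) ^ 2 = z := fun z => by
    have := Complex.cpow_nat_inv_pow z two_ne_zero
    simpa only [Nat.cast_ofNat, one_div] using this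
  have hs : 0.98 ≤ ‖((1 + 2 / c) ^ (1 / 2 : ℂ)) ^ 2‖ := by
    rw [hsq]
    have := norm_sub_norm_le (1 : ℂ) (-(2 / c))
    rw [sub_neg_eq_add, norm_neg, norm_one] at this
    linarith
  have ht : 0.98 ≤ ‖((1 - 2 / c) ^ (1 / 2 : ℂ)) ^ 2‖ := by
    rw [hsq]
    have := norm_sub_norm_le (1 : ℂ) (2 / c)
    rw [norm_one] at this
    linarith
  obtain ⟨V', hV', hVle⟩ := exists_sign_norm_sub_le (V := V) (w := μ) (δ := -(2 / c)) hs hU0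
    (by rw [hsq]; field_simp; linear_combination hVU) hμ1
  obtain ⟨Z', hZ', hZle⟩ := exists_sign_norm_sub_le (V := Z) (w := μ) (δ := 2 / c) ht hU0
    (by rw [hsq]; field_simp; linear_combination hZU) hμ1
  have hV'O : V' ∈ O := by
    rcases hV' with rfl | rfl
    · exact hV
    · exact O.neg_mem hV
  have hZ'O : Z' ∈ O := by
    rcases hZ' with rfl | rfl
    · exact hZ
    · exact O.neg_mem hZ
  obtain ⟨k, hk, hk1, hk2⟩ := exists_pade_level hC hu
  have hbound := one_le_pade_bound hO hc hU hV'O hZ'O hU0 (by linarith) hk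
  rw [norm_neg, hxn] at hVle
  rw [hxn] at hZle
  -- The constant is `1.01 * 1.02 * 4 = 4.1208 < 4.2`. Both terms of `hbound` are now controlled by
  -- `1/2`, the first strictly.
  have hsum : 1.01 * (11 * ‖c‖) ^ k *
      (‖V' - (1 + 2 / c) ^ (1 / 2 : ℂ) * U‖ + ‖Z' - (1 - 2 / c) ^ (1 / 2 : ℂ) * U‖) ≤ 1 / 2 := by
    calc _ ≤ 1.01 * (11 * ‖c‖) ^ k *
          (1.02 * (2 / ‖c‖) / ‖U‖ + 1.02 * (2 / ‖c‖) / ‖U‖) := by gcongr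
      _ = 4.1208 * (11 * ‖c‖) ^ k / (‖c‖ * ‖U‖) := by field_simp; norm_num
      _ ≤ 1 / 2 := by
        rw [div_le_iff₀ (by positivity)]
        have : 0 < (11 * ‖c‖) ^ k := by positivity
        linarith
  linarith

end Approximation

/-! ### Integers of imaginary quadratic fields. -/

section QuadraticField

variable {D : ℕ}

theorem exists_rat_of_mem_imagQuad {z : ℂ} (hz : z ∈ ImagQuad D) :
    ∃ a b : ℚ, z = a + b * (((Real.sqrt D : ℝ) : ℂ) * Complex.I) := by
  set θ : ℂ := ((Real.sqrt D : ℝ) : ℂ) * Complex.I with hθ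
  have hθ2 : θ ^ 2 = -(D : ℂ) := by
    rw [hθ, mul_pow, Complex.I_sq, ← Complex.ofReal_pow, Real.sq_sqrt (Nat.cast_nonneg D)]
    simp
  induction hz using IntermediateField.adjoin_induction with
  | mem x hx => exact ⟨0, 1, by rw [Set.mem_singleton_iff.mp hx, ← hθ]; simp⟩
  | algebraMap q => exact ⟨q, 0, by simp⟩
  | add x y _ _ hx hy =>
    obtain ⟨a, b, rfl⟩ := hx
    obtain ⟨a', b', rfl⟩ := hy
    exact ⟨a + a', b + b', by push_cast; ring⟩
  | mul x y _ _ hx hy =>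
    obtain ⟨a, b, rfl⟩ := hx
    obtain ⟨a', b', rfl⟩ := hy
    exact ⟨a * a' - D * b * b', a * b' + a' * b, by
      push_cast; linear_combination (b : ℂ) * b' * hθ2⟩
  | inv x _ hx =>
    obtain ⟨a, b, rfl⟩ := hx
    by_cases h0 : (a : ℂ) + b * θ = 0
    · exact ⟨0, 0, by simp [h0]⟩
    · have hc : ((a : ℂ) - b * θ) ≠ 0 := by
        intro h
        apply h0
        have := congrArg (starRingEnd ℂ) h
        simpa [hθ] using this
      have hprod : ((a : ℂ) + b * θ) * (a - b * θ) = a ^ 2 + D * b ^ 2 := by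
        linear_combination -(b : ℂ) ^ 2 * hθ2
      have hne : ((a : ℂ) ^ 2 + D * b ^ 2) ≠ 0 := hprod ▸ mul_ne_zero h0 hc
      refine ⟨a / (a ^ 2 + D * b ^ 2), -b / (a ^ 2 + D * b ^ 2), ?_⟩
      refine inv_eq_of_mul_eq_one_right ?_
      push_cast
      rw [← div_self hne, ← hprod]
      ring

theorem exists_int_of_isIntegral_ratCast {q : ℚ} (h : IsIntegral ℤ (q : ℂ)) : ∃ n : ℤ, q = n := by
  have h' : IsIntegral ℤ q :=
    (isIntegral_algebraMap_iff (algebraMap ℚ ℂ).injective).mp (by simpa using h)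
  obtain ⟨n, hn⟩ := IsIntegrallyClosed.isIntegral_iff.mp h'
  exact ⟨n, by simpa using hn.symm⟩

/-- Trace and norm of an integer of an imaginary quadratic field. -/
theorem exists_int_trace_norm {z : ℂ} (hz : z ∈ ImagQuad D) (hi : IsIntegral ℤ z) :
    (∃ t : ℤ, z + starRingEnd ℂ z = t) ∧ ∃ n : ℤ, z * starRingEnd ℂ z = n := by
  obtain ⟨a, b, hab⟩ := exists_rat_of_mem_imagQuad hz
  have hconj : IsIntegral ℤ (starRingEnd ℂ z) :=
    hi.map ((starRingEnd ℂ).toIntAlgHom)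
  have hs : starRingEnd ℂ z = a - b * (((Real.sqrt D : ℝ) : ℂ) * Complex.I) := by
    rw [hab]; simp; ring
  have hθ2 : (((Real.sqrt D : ℝ) : ℂ) * Complex.I) ^ 2 = -(D : ℂ) := by
    rw [mul_pow, Complex.I_sq, ← Complex.ofReal_pow, Real.sq_sqrt (Nat.cast_nonneg D)]
    simp
  constructor
  · have e : z + starRingEnd ℂ z = ((2 * a : ℚ) : ℂ) := by rw [hs, hab]; push_cast; ring
    obtain ⟨n, hn⟩ := exists_int_of_isIntegral_ratCast (e ▸ hi.add hconj)
    exact ⟨n, by rw [e, hn]; simp⟩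
  · have e : z * starRingEnd ℂ z = ((a ^ 2 + D * b ^ 2 : ℚ) : ℂ) := by
      rw [hs, hab]; push_cast; linear_combination -(b : ℂ) ^ 2 * hθ2
    obtain ⟨n, hn⟩ := exists_int_of_isIntegral_ratCast (e ▸ hi.mul hconj)
    exact ⟨n, by rw [e, hn]; simp⟩

/-- `|z|²` is the norm of `z`, a positive rational integer. This discreteness is what the Padé
argument uses. -/
theorem one_le_norm_of_isIntegral {z : ℂ} (hz : z ∈ ImagQuad D) (hi : IsIntegral ℤ z)
    (h0 : z ≠ 0) : 1 ≤ ‖z‖ := by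
  obtain ⟨-, n, hn⟩ := exists_int_trace_norm hz hi
  rw [Complex.mul_conj, Complex.normSq_eq_norm_sq] at hn
  have hn' : ‖z‖ ^ 2 = (n : ℝ) := by exact_mod_cast hn
  have hpos : 0 < ‖z‖ := norm_pos_iff.mpr h0
  have : (0 : ℝ) < n := by rw [← hn']; positivity
  have h1 : (1 : ℝ) ≤ n := by exact_mod_cast this
  nlinarith

theorem omega3_sq_add : omega3 ^ 2 + omega3 + 1 = 0 := by
  have h3 : ((Real.sqrt 3 : ℝ) : ℂ) ^ 2 = 3 := by
    rw [← Complex.ofReal_pow, Real.sq_sqrt (by norm_num)]; norm_num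
  rw [omega3]
  linear_combination (1 / 4) * ((Real.sqrt 3 : ℝ) : ℂ) ^ 2 * Complex.I_sq - (1 / 4) * h3

theorem Corresponds.sq_eq {μ ε : ℂ} (h : Corresponds μ ε) : ε ^ 2 = μ := by
  have := omega3_sq_add
  rcases h with ⟨rfl, rfl⟩ | ⟨rfl, rfl⟩ | ⟨rfl, rfl⟩ | ⟨rfl, rfl⟩
  · norm_num
  · exact Complex.I_sq
  · linear_combination (omega3 ^ 2 - omega3) * this
  · rfl

/-- The integers of absolute value one of an imaginary quadratic field. -/
theorem exists_corresponds_sq {z : ℂ} (hz : z ∈ ImagQuad D) (hi : IsIntegral ℤ z)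
    (h1 : ‖z‖ = 1) : ∃ ε, Corresponds (z ^ 2) ε ∧ (z = ε ∨ z = -ε) := by
  obtain ⟨⟨t, ht⟩, -⟩ := exists_int_trace_norm hz hi
  have hn : z * starRingEnd ℂ z = 1 := by
    rw [Complex.mul_conj, Complex.normSq_eq_norm_sq, h1]; norm_num
  have hpoly : z ^ 2 - t * z + 1 = 0 := by linear_combination z * ht - hn
  have habs : |(t : ℝ)| ≤ 2 := by
    have := norm_add_le z (starRingEnd ℂ z)
    rw [ht, RCLike.norm_conj, h1, Complex.norm_intCast] at this
    linarith
  have hω := omega3_sq_add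
  have ht1 : t ≤ 2 := by exact_mod_cast (abs_le.mp habs).2
  have ht2 : -2 ≤ t := by exact_mod_cast (abs_le.mp habs).1
  have hcase : ∀ α β : ℂ, (z - α) * (z - β) = 0 → z = α ∨ z = β := fun α β h => by
    rcases mul_eq_zero.mp h with h | h
    · exact Or.inl (sub_eq_zero.mp h)
    · exact Or.inr (sub_eq_zero.mp h)
  -- The trace `t` runs over `-2, ..., 2`; the roots of `z² - t z + 1` are `-1`; `ω, ω²`; `±i`; `-ω,
  -- -ω²`; `1`.
  interval_cases t <;> push_cast at hpoly
  · obtain rfl : z = -1 := by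
      rcases hcase (-1) (-1) (by linear_combination hpoly) with h | h <;> exact h
    exact ⟨1, Or.inl ⟨by norm_num, rfl⟩, Or.inr rfl⟩
  · rcases hcase omega3 (omega3 ^ 2) (by
      linear_combination hpoly + (omega3 - 1 - z) * hω) with rfl | rfl
    · exact ⟨omega3, Or.inr (Or.inr (Or.inr ⟨rfl, rfl⟩)), Or.inl rfl⟩
    · exact ⟨omega3 ^ 2, Or.inr (Or.inr (Or.inl
        ⟨by linear_combination (omega3 ^ 2 - omega3) * hω, rfl⟩)), Or.inl rfl⟩
  · have h2 : z ^ 2 = -1 := by linear_combination hpoly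
    refine ⟨Complex.I, Or.inr (Or.inl ⟨h2, rfl⟩), ?_⟩
    exact hcase _ _ (by linear_combination h2 - Complex.I_sq)
  · rcases hcase (-omega3) (-omega3 ^ 2) (by
      linear_combination hpoly + (omega3 - 1 + z) * hω) with rfl | rfl
    · exact ⟨omega3, Or.inr (Or.inr (Or.inr ⟨by ring, rfl⟩)), Or.inr rfl⟩
    · exact ⟨omega3 ^ 2, Or.inr (Or.inr (Or.inl
        ⟨by linear_combination (omega3 ^ 2 - omega3) * hω, rfl⟩)), Or.inr rfl⟩
  · obtain rfl : z = 1 := by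
      rcases hcase 1 1 (by linear_combination hpoly) with h | h <;> exact h
    exact ⟨1, Or.inl ⟨by norm_num, rfl⟩, Or.inl rfl⟩

/-- The embedding of the ring of integers of `ℚ(√-D)` into `ℂ`. -/
noncomputable def ringOfIntegersEmbedding (D : ℕ) : 𝓞 (ImagQuad D) →+* ℂ :=
  (algebraMap (ImagQuad D) ℂ).comp (algebraMap (𝓞 (ImagQuad D)) (ImagQuad D))

theorem ringOfIntegersEmbedding_injective (D : ℕ) :
    Function.Injective (ringOfIntegersEmbedding D) :=
  (algebraMap (ImagQuad D) ℂ).injective.comp NumberField.RingOfIntegers.coe_injective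

theorem isIntegral_ringOfIntegersEmbedding (z : 𝓞 (ImagQuad D)) :
    IsIntegral ℤ (ringOfIntegersEmbedding D z) :=
  (NumberField.RingOfIntegers.isIntegral_coe z).map
    ((algebraMap (ImagQuad D) ℂ).toIntAlgHom)

theorem ringOfIntegersEmbedding_mem (z : 𝓞 (ImagQuad D)) :
    ringOfIntegersEmbedding D z ∈ ImagQuad D := (z : ImagQuad D).2

theorem one_le_norm_of_mem_range :
    ∀ z ∈ (ringOfIntegersEmbedding D).range, z ≠ 0 → 1 ≤ ‖z‖ := by
  rintro _ ⟨z, rfl⟩ h0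
  exact one_le_norm_of_isIntegral (ringOfIntegersEmbedding_mem z)
    (isIntegral_ringOfIntegersEmbedding z) h0

/-- The unit and its inverse both have absolute value at least one, and their product is `1`. -/
theorem norm_unit_eq_one (μ : (𝓞 (ImagQuad D))ˣ) :
    ‖ringOfIntegersEmbedding D μ‖ = 1 := by
  have hprod : ringOfIntegersEmbedding D μ * ringOfIntegersEmbedding D (μ⁻¹ : (𝓞 (ImagQuad D))ˣ) = 1 := by
    rw [← map_mul, Units.mul_inv, map_one]
  have h1 := one_le_norm_of_mem_range _ ⟨(μ : 𝓞 (ImagQuad D)), rfl⟩ (left_ne_zero_of_mul_eq_one hprod)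
  have h2 := one_le_norm_of_mem_range _ ⟨((μ⁻¹ : (𝓞 (ImagQuad D))ˣ) : 𝓞 (ImagQuad D)), rfl⟩
    (right_ne_zero_of_mul_eq_one hprod)
  have h3 := congrArg norm hprod
  rw [norm_mul, norm_one] at h3
  nlinarith

theorem pellSystem_map_iff {R S : Type*} [CommRing R] [CommRing S] (f : R →+* S)
    (hf : Function.Injective f) (c μ U V Z : R) :
    PellSystem (f c) (f μ) (f U) (f V) (f Z) ↔ PellSystem c μ U V Z := by
  have h0 : f 2 = 2 := map_ofNat f 2
  have h1 : f (c * V ^ 2 - (c + 2) * U ^ 2) = f c * f V ^ 2 - (f c + 2) * f U ^ 2 := by simp [h0]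
  have h2 : f ((c - 2) * U ^ 2 - c * Z ^ 2) = (f c - 2) * f U ^ 2 - f c * f Z ^ 2 := by simp [h0]
  have h3 : f (-2 * μ) = -2 * f μ := by simp [h0]
  simp only [PellSystem, ← h1, ← h2, ← h3, hf.eq_iff]

end QuadraticField

theorem mainTheorem4 (D : ℕ) (hD : Squarefree D) (c : 𝓞 (ImagQuad D))
    (hc : 159108 ≤ ‖((c : ImagQuad D) : ℂ)‖)
    (μ : (𝓞 (ImagQuad D))ˣ) (U V Z : 𝓞 (ImagQuad D)) :
    PellSystem c (μ : 𝓞 (ImagQuad D)) U V Z ↔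
      ∃ ε : ℂ, Corresponds (((μ : 𝓞 (ImagQuad D)) : ImagQuad D) : ℂ) ε ∧
        (((U : ImagQuad D) : ℂ) = ε ∨ ((U : ImagQuad D) : ℂ) = -ε) ∧
        (((V : ImagQuad D) : ℂ) = ε ∨ ((V : ImagQuad D) : ℂ) = -ε) ∧
        (((Z : ImagQuad D) : ℂ) = ε ∨ ((Z : ImagQuad D) : ℂ) = -ε) := by
  rw [← pellSystem_map_iff _ (ringOfIntegersEmbedding_injective D)]
  have hμ := norm_unit_eq_one μ
  have hUm := ringOfIntegersEmbedding_mem U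
  have hUi := isIntegral_ringOfIntegersEmbedding U
  have mem : ∀ w : 𝓞 (ImagQuad D),
      ringOfIntegersEmbedding D w ∈ (ringOfIntegersEmbedding D).range := fun w => ⟨w, rfl⟩
  have hmc := mem c
  have hmU := mem U
  have hmV := mem V
  have hmZ := mem Z
  change 159108 ≤ ‖ringOfIntegersEmbedding D c‖ at hc
  change _ ↔ ∃ ε : ℂ, Corresponds (ringOfIntegersEmbedding D μ) ε ∧
    (ringOfIntegersEmbedding D U = ε ∨ ringOfIntegersEmbedding D U = -ε) ∧
    (ringOfIntegersEmbedding D V = ε ∨ ringOfIntegersEmbedding D V = -ε) ∧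
    (ringOfIntegersEmbedding D Z = ε ∨ ringOfIntegersEmbedding D Z = -ε)
  constructor
  · intro h
    obtain ⟨hU2, hV2, hZ2⟩ := sq_eq_of_pellSystem one_le_norm_of_mem_range hmc hmU hmV hmZ hμ hc h
    have hU1 : ‖ringOfIntegersEmbedding D U‖ = 1 := by
      have := congrArg norm hU2
      rw [norm_pow, hμ] at this
      exact (pow_eq_one_iff_of_nonneg (norm_nonneg _) two_ne_zero).mp this
    obtain ⟨ε, hε, hUε⟩ := exists_corresponds_sq hUm hUi hU1
    rw [hU2] at hε
    refine ⟨ε, hε, hUε, ?_, ?_⟩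
    · exact sq_eq_sq_iff_eq_or_eq_neg.mp (hV2.trans hε.sq_eq.symm)
    · exact sq_eq_sq_iff_eq_or_eq_neg.mp (hZ2.trans hε.sq_eq.symm)
  · rintro ⟨ε, hε, hU, hV, hZ⟩
    -- Only the squares enter the system, so the signs are independent; all three squares equal `ε²
    -- = μ`.
    have hU2 := (sq_eq_sq_iff_eq_or_eq_neg.mpr hU).trans hε.sq_eq
    have hV2 := (sq_eq_sq_iff_eq_or_eq_neg.mpr hV).trans hε.sq_eq
    have hZ2 := (sq_eq_sq_iff_eq_or_eq_neg.mpr hZ).trans hε.sq_eq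
    constructor
    · rw [hU2, hV2]; ring
    · rw [hU2, hZ2]; ring
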